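/- **Fully Online Matching.** An instance consists of a finite simple graph $G=(V,E)$ (not necessarily bipartite) together with a finite sequence of time steps in which every vertex $v\in V$ has exactly one *arrival* and exactly one *deadline*; each vertex arrives before its own deadline, and all neighbors of a vertex arrive before its deadline. The instance is fixed in advance (oblivious adversary). **Ranking.** On its arrival, each vertex $v$ independently draws a rank $y_v$ uniformly at random from $[0,1)$. When the deadline of a vertex $v$ is reached and $v$ is still unmatched, $v$ is matched to its unmatched neighbor of smallest rank; if $v$ has no unmatched neighbor, it remains unmatched. (Ties between ranks, an event of probability $0$, are broken in favor of the earlier arrival.) Let $M(y)$ be the set of edges matched at the end of the run with ranks $y=(y_v)_{v\in V}$. **Theorem.** Ranking is $0.5211$-competitive for Fully Online Matching on general graphs. That is, for every instance, $M(y)$ is a matching of $G$ for every $y$, the size $|M(y)|$ is an integrable function of $y$, and $$\mathbb{E}_{y}\big[\,|M(y)|\,\big]\;\ge\;0.5211\cdot \mathrm{OPT}(G),$$ where $y$ is distributed uniformly on $[0,1)^V$ and $\mathrm{OPT}(G)$ is the number of edges of a maximum matching of $G$. -/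

import Mathlib

namespace FullyOnlineMatching

/-- A time step of the fully online model: the arrival of a vertex, or the deadline of a vertex. -/
inductive Event (V : Type*) where
  | arrival (v : V)
  | deadline (v : V)

/-- An instance of Fully Online Matching on the vertex set `V`, fixed in advance by the oblivious
adversary: the underlying graph, and the sequence of all arrivals and deadlines in the order in
which they happen. `[a, b].Sublist timeline` says that `a` happens before `b`. -/
structure Instance (V : Type*) where
  /-- the underlying graph (not necessarily bipartite) -/
  graph : SimpleGraph V
  /-- the time steps, in chronological order -/
  timeline : List (Event V)
  /-- no event happens twice -/
  nodup : timeline.Nodup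
  /-- every vertex arrives and has a deadline -/
  complete : ∀ e : Event V, e ∈ timeline
  /-- a vertex arrives before its deadline -/
  arrival_before_deadline : ∀ v : V,
    [Event.arrival v, Event.deadline v].Sublist timeline
  /-- the neighbors of a vertex arrive before its deadline -/
  neighbor_arrival_before_deadline : ∀ u v : V, graph.Adj u v →
    [Event.arrival u, Event.deadline v].Sublist timeline

/-- What the algorithm has recorded at some moment: the vertices that have arrived so far, in the
order of their arrivals, and the edges that have been matched so far. -/
structure State (V : Type*) where
  arrived : List V
  matching : Finset (Sym2 V)

/-- The vertex `v` is an endpoint of an edge that has already been matched. -/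
def State.IsMatched {V : Type*} (s : State V) (v : V) : Prop :=
  ∃ e ∈ s.matching, v ∈ e

open Classical in
/-- One time step of Ranking with ranks `y`. On an arrival no decision is made. On the deadline of
an unmatched vertex `v`, it is matched to its unmatched neighbor of smallest rank, if there is an
unmatched neighbor. (`List.argmin` returns the first minimizer in the list, so equal ranks, an event
of probability zero, are resolved in favor of the earlier arrival.) -/
noncomputable def rankingStep {V : Type*} (G : SimpleGraph V) (y : V → ℝ) (s : State V) :
    Event V → State V
  | .arrival v => { s with arrived := s.arrived ++ [v] }
  | .deadline v =>
      if s.IsMatched v then s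
      else
        match (s.arrived.filter (fun u => G.Adj v u ∧ ¬ s.IsMatched u)).argmin y with
        | none => s
        | some u => { s with matching := insert s(v, u) s.matching }

/-- The set of matched edges `M(y)` at the end of the run of Ranking with ranks `y`. -/
noncomputable def Instance.ranking {V : Type*} (I : Instance V) (y : V → ℝ) : Finset (Sym2 V) :=
  (I.timeline.foldl (rankingStep I.graph y) ⟨[], ∅⟩).matching

/-- The joint law of the ranks: independent and uniform on `[0, 1)`. -/
noncomputable def rankMeasure (V : Type*) [Fintype V] : MeasureTheory.Measure (V → ℝ) :=
  MeasureTheory.Measure.pi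
    (fun _ : V => MeasureTheory.volume.restrict (Set.Ico (0 : ℝ) 1))

/-- The number of edges of a maximum matching of a (finite) graph. -/
noncomputable def maxMatchingSize {V : Type*} (G : SimpleGraph V) : ℕ :=
  sSup {k : ℕ | ∃ M : G.Subgraph, M.IsMatching ∧ M.edgeSet.ncard = k}

end FullyOnlineMatching

/-!
The proof shares the weight of every matched edge between its endpoints. When the deadline of an
unmatched vertex `a` is reached and `a` is matched to `c`, call `a` active and `c` passive; `c`
gains `share (y c)` and `a` gains `1 - share (y c)`, for a nondecreasing step function `share`. The
total gain does not exceed the number of matched edges (`sum_gain_le`), so it suffices that for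
every edge `uv` of the graph the expected gain of `u` and `v` together is at least `0.5211`
(`Critical.le_integral_gain`); summing over the edges of a maximum matching gives the theorem.

Let `u` be the endpoint with the earlier deadline, and look at the moment before that deadline.
Consider first the run in which `u` and `v` are not available. It determines thresholds `s` of `u`
and `b` of `v`: the largest rank that some active vertex would prefer to its actual partner. It also
determines the spare neighbors of `u`, which are unmatched at that moment. If both `u` and `v` have
ranks above their thresholds, the full run agrees with this run so far; if not, one of the two with
a rank below its threshold is matched passively (`run_dichotomy`). In the first case `u` then picks
the better one of `v` and the best spare neighbor, of rank `ρ` say (`Critical.gain_clean`). If only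
`v` is below its threshold and `u` has two spare neighbors, at most one of these is lost when `v`
joins the run (`almostEq_free`), so `u` gets matched as well (`Critical.gain_second`).

Averaging over the ranks of `u` and `v` alone gives an explicit lower bound in terms of `s`, `b` and
`ρ` (`le_integral_of_profile_le`). It is at least `0.5211` if there is no spare neighbor
(`bound_no_spare`) and if there are at least two (`bound_two_spare`), but not always if there is
exactly one, `x`. In that case one also averages over the rank of `x`: raising it changes neither
the run without `u` and `v` nor the fact that `x` is the only spare neighbor (`free_raise`,
`thr_raise`), so that the rank of `x` is uniform on an interval `[lo, 1)` on which `s` and `b` are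
constant (`integral_nonneg_of_one_spare`, `bound_one_spare`). Averaging over a single rank is
legitimate because redrawing one rank preserves the joint law (`measurePreserving_update`).

Runs are described by histories, lists of events with the latest event first, so that the sets of
unmatched vertices and the matched pairs are defined by structural recursion; a vertex is removed
from the graph by declaring it unavailable.
-/

open MeasureTheory

namespace FullyOnlineMatching

/-! ### First minimizers of lists -/

/-- A first minimizer remains the first minimizer when other entries are left out. -/
theorem argmin_filter {α : Type*} (f : α → ℝ) (p : α → Bool) {l : List α} {m : α}
    (h : l.argmin f = some m) (hm : p m) : (l.filter p).argmin f = some m := by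
  induction l with
  | nil => simp at h
  | cons a l ih =>
    rw [List.argmin_cons] at h
    cases hc : l.argmin f with
    | none =>
      obtain rfl := List.argmin_eq_none.1 hc
      simp only [hc, Option.some.injEq] at h
      subst h
      simp [hm]
    | some c =>
      simp only [hc] at h
      by_cases hlt : f c < f a
      · simp only [hlt, if_true, Option.some.injEq] at h
        subst h
        by_cases ha : p a
        · rw [List.filter_cons_of_pos ha, List.argmin_cons, ih hc]
          simp [hlt]
        · rw [List.filter_cons_of_neg ha, ih hc]
      · simp only [hlt, if_false, Option.some.injEq] at h
        subst h
        rw [List.filter_cons_of_pos hm, List.argmin_cons]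
        cases hd : (l.filter p).argmin f with
        | none => rfl
        | some d =>
          have h1 : d ∈ l := List.mem_of_mem_filter (List.argmin_mem hd)
          have h2 : f c ≤ f d := List.le_of_mem_argmin h1 hc
          have : ¬ f d < f a := by linarith
          simp [this]

/-- The first minimizer depends only on the order of the values. -/
theorem argmin_congr_order {α : Type*} {f g : α → ℝ} {l : List α}
    (h : ∀ a ∈ l, ∀ b ∈ l, (f a ≤ f b ↔ g a ≤ g b)) : l.argmin f = l.argmin g := by
  classical
  ext m
  simp only [List.argmin_eq_some_iff]
  constructor
  · rintro ⟨h1, h2, h3⟩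
    exact ⟨h1, fun a ha => (h _ h1 _ ha).1 (h2 a ha), fun a ha hh => h3 a ha ((h _ ha _ h1).2 hh)⟩
  · rintro ⟨h1, h2, h3⟩
    exact ⟨h1, fun a ha => (h _ h1 _ ha).2 (h2 a ha), fun a ha hh => h3 a ha ((h _ ha _ h1).1 hh)⟩

/-- A first minimizer remains the first minimizer when the value of another entry is raised. -/
theorem argmin_raise {α : Type*} {f g : α → ℝ} {l : List α} {x m : α}
    (h : l.argmin f = some m) (hmx : m ≠ x) (hfg : ∀ a, a ≠ x → g a = f a) (hx : f x ≤ g x) :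
    l.argmin g = some m := by
  classical
  rw [List.argmin_eq_some_iff] at h ⊢
  obtain ⟨h1, h2, h3⟩ := h
  have key : ∀ a, f a ≤ g a := fun a => by
    by_cases hax : a = x
    · rw [hax]; exact hx
    · exact (hfg a hax).ge
  refine ⟨h1, fun a ha => ?_, fun a ha hh => h3 a ha ?_⟩
  · rw [hfg m hmx]; exact (h2 a ha).trans (key a)
  · rw [hfg m hmx] at hh; exact (key a).trans hh

/-! ### Runs of Ranking from a given set of available vertices -/

section Run

variable {V : Type*}

open Classical in
/-- The available neighbor of `a` of smallest rank in the list `L`, where `S` is the set of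
available vertices. -/
noncomputable def pick (G : SimpleGraph V) (y : V → ℝ) (L : List V) (S : Set V) (a : V) :
    Option V :=
  (L.filter (fun w => G.Adj a w ∧ w ∈ S)).argmin y

variable {G : SimpleGraph V} {y y' : V → ℝ} {L : List V} {S S' : Set V} {a c w : V}

theorem pick_mem (h : pick G y L S a = some c) : c ∈ L ∧ G.Adj a c ∧ c ∈ S := by
  classical
  have := List.argmin_mem h
  simpa [List.mem_filter] using this

theorem pick_le (h : pick G y L S a = some c) (hw : w ∈ L) (ha : G.Adj a w) (hS : w ∈ S) :
    y c ≤ y w := by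
  classical
  refine List.le_of_mem_argmin ?_ h
  simp [List.mem_filter, hw, ha, hS]

theorem pick_ne_none (hw : w ∈ L) (ha : G.Adj a w) (hS : w ∈ S) : pick G y L S a ≠ none := by
  classical
  intro h
  have := List.argmin_eq_none.1 h
  have h2 : w ∈ L.filter (fun w => G.Adj a w ∧ w ∈ S) := by simp [List.mem_filter, hw, ha, hS]
  rw [this] at h2
  simp at h2

theorem pick_eq_none (h : ∀ w ∈ L, G.Adj a w → w ∉ S) : pick G y L S a = none := by
  cases hc : pick G y L S a with
  | none => rfl
  | some c => exact absurd (pick_mem hc).2.2 (h c (pick_mem hc).1 (pick_mem hc).2.1)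

/-- The choice does not change when vertices that were not chosen become unavailable. -/
theorem pick_subset (hS : S' ⊆ S) (h : pick G y L S a = some c) (hc : c ∈ S') :
    pick G y L S' a = some c := by
  classical
  have h1 := argmin_filter y (fun w => decide (w ∈ S')) h (by simpa using hc)
  rw [List.filter_filter] at h1
  unfold pick
  rw [← h1]
  congr 1
  apply List.filter_congr
  intro w _
  have := @hS w
  by_cases h1 : w ∈ S' <;> simp [h1]
  intro _
  exact this h1

theorem pick_subset_none (hS : S' ⊆ S) (h : pick G y L S a = none) :
    pick G y L S' a = none :=
  pick_eq_none fun _ hw ha hw' => pick_ne_none hw ha (hS hw') h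

theorem pick_congr_order (h : ∀ a ∈ S, ∀ b ∈ S, (y a ≤ y b ↔ y' a ≤ y' b)) :
    pick G y L S a = pick G y' L S a := by
  classical
  refine argmin_congr_order fun a ha b hb => ?_
  simp only [List.mem_filter, decide_eq_true_eq] at ha hb
  exact h a ha.2.2 b hb.2.2

/-- The vertices that have arrived, in the order of their arrivals. A history is a list of events
with the latest event first. -/
def arrivals : List (Event V) → List V
  | [] => []
  | .arrival v :: h => arrivals h ++ [v]
  | .deadline _ :: h => arrivals h

open Classical in
/-- The vertices that are still unmatched after the history `h` when Ranking is run with only the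
vertices in `W` available for matching. Removing vertices from the graph amounts to leaving them
out of `W`. -/
noncomputable def free (G : SimpleGraph V) (y : V → ℝ) (W : Set V) : List (Event V) → Set V
  | [] => W
  | .arrival _ :: h => free G y W h
  | .deadline a :: h =>
      match (if a ∈ free G y W h then pick G y (arrivals h) (free G y W h) a else none) with
      | none => free G y W h
      | some c => free G y W h \ {a, c}

open Classical in
/-- The vertex to which `a` is matched if its deadline comes right after the history `h`. -/
noncomputable def choice (G : SimpleGraph V) (y : V → ℝ) (W : Set V) (h : List (Event V)) (a : V) :
    Option V :=
  if a ∈ free G y W h then pick G y (arrivals h) (free G y W h) a else none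

/-- The matched pairs, each consisting of an active vertex (the one whose deadline was reached) and
of its passive partner. -/
noncomputable def pairs (G : SimpleGraph V) (y : V → ℝ) (W : Set V) : List (Event V) → List (V × V)
  | [] => []
  | .arrival _ :: h => pairs G y W h
  | .deadline a :: h =>
      match choice G y W h a with
      | none => pairs G y W h
      | some c => (a, c) :: pairs G y W h

variable {W W' : Set V} {h : List (Event V)} {x u v : V}

theorem free_nil : free G y W [] = W := rfl

theorem free_deadline_none (hc : choice G y W h a = none) :
    free G y W (.deadline a :: h) = free G y W h := by
  unfold choice at hc
  rw [free, hc]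

theorem free_deadline_some (hc : choice G y W h a = some c) :
    free G y W (.deadline a :: h) = free G y W h \ {a, c} := by
  unfold choice at hc
  rw [free, hc]

theorem pairs_deadline_none (hc : choice G y W h a = none) :
    pairs G y W (.deadline a :: h) = pairs G y W h := by
  rw [pairs, hc]

theorem pairs_deadline_some (hc : choice G y W h a = some c) :
    pairs G y W (.deadline a :: h) = (a, c) :: pairs G y W h := by
  rw [pairs, hc]

theorem choice_of_mem (ha : a ∈ free G y W h) :
    choice G y W h a = pick G y (arrivals h) (free G y W h) a := by
  rw [choice, if_pos ha]

theorem choice_of_notMem (ha : a ∉ free G y W h) : choice G y W h a = none := by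
  rw [choice, if_neg ha]

theorem mem_free_of_choice (hc : choice G y W h a = some c) : a ∈ free G y W h := by
  by_contra ha
  simp [choice_of_notMem ha] at hc

theorem pick_of_choice (hc : choice G y W h a = some c) :
    pick G y (arrivals h) (free G y W h) a = some c := by
  rwa [choice_of_mem (mem_free_of_choice hc)] at hc

theorem free_cons_subset (e : Event V) : free G y W (e :: h) ⊆ free G y W h := by
  cases e with
  | arrival x => exact subset_rfl
  | deadline a =>
    cases hc : choice G y W h a with
    | none => rw [free_deadline_none hc]
    | some c => rw [free_deadline_some hc]; exact Set.sdiff_subset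

theorem free_append_subset (h' : List (Event V)) : free G y W (h' ++ h) ⊆ free G y W h := by
  induction h' with
  | nil => exact subset_rfl
  | cons e h' ih => exact (free_cons_subset e).trans ih

theorem free_subset (h : List (Event V)) : free G y W h ⊆ W := by
  have := @free_append_subset V G y W [] h
  rwa [List.append_nil] at this

theorem pairs_subset_append (h' : List (Event V)) : pairs G y W h ⊆ pairs G y W (h' ++ h) := by
  induction h' with
  | nil => exact List.Subset.refl _
  | cons e h' ih =>
    refine List.Subset.trans ih ?_
    cases e with
    | arrival x => exact List.Subset.refl _
    | deadline a =>
      rw [List.cons_append]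
      cases hc : choice G y W (h' ++ h) a with
      | none => rw [pairs_deadline_none hc]; exact List.Subset.refl _
      | some c => rw [pairs_deadline_some hc]; exact List.subset_cons_self _ _

/-- A vertex stops being available only by being matched, actively or passively. -/
theorem exists_pair_of_notMem_free (hW : x ∈ W) (hx : x ∉ free G y W h) :
    ∃ c, (x, c) ∈ pairs G y W h ∨ (c, x) ∈ pairs G y W h := by
  induction h with
  | nil => exact absurd hW hx
  | cons e h ih =>
    cases e with
    | arrival z => exact ih hx
    | deadline a =>
      cases hc : choice G y W h a with
      | none =>
        rw [free_deadline_none hc] at hx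
        rw [pairs_deadline_none hc]
        exact ih hx
      | some c =>
        rw [free_deadline_some hc] at hx
        rw [pairs_deadline_some hc]
        by_cases hx' : x ∈ free G y W h
        · have : x = a ∨ x = c := by
            by_contra hne
            exact hx ⟨hx', by simpa using hne⟩
          rcases this with rfl | rfl
          · exact ⟨c, by simp⟩
          · exact ⟨a, by simp⟩
        · obtain ⟨d, hd⟩ := ih hx'
          exact ⟨d, hd.imp (List.mem_cons_of_mem _) (List.mem_cons_of_mem _)⟩

theorem exists_deadline_of_mem_pairs (hp : (a, c) ∈ pairs G y W h) :
    Event.deadline a ∈ h := by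
  induction h with
  | nil => simp [pairs] at hp
  | cons e h ih =>
    cases e with
    | arrival z => exact List.mem_cons_of_mem _ (ih hp)
    | deadline b =>
      cases hc : choice G y W h b with
      | none => rw [pairs_deadline_none hc] at hp; exact List.mem_cons_of_mem _ (ih hp)
      | some d =>
        rw [pairs_deadline_some hc, List.mem_cons] at hp
        rcases hp with hp | hp
        · rw [Prod.mk.injEq] at hp
          rw [hp.1]; exact List.mem_cons_self
        · exact List.mem_cons_of_mem _ (ih hp)

/-- The run depends only on the order of the ranks of the available vertices. -/
theorem run_congr_order (hy : ∀ a ∈ W, ∀ b ∈ W, (y a ≤ y b ↔ y' a ≤ y' b)) :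
    free G y W h = free G y' W h ∧ pairs G y W h = pairs G y' W h := by
  have hch : ∀ h, free G y W h = free G y' W h → choice G y W h = choice G y' W h := by
    intro h hf
    funext a
    unfold choice
    rw [hf, pick_congr_order]
    intro a ha b hb
    exact hy a (free_subset _ ha) b (free_subset _ hb)
  induction h with
  | nil => exact ⟨rfl, rfl⟩
  | cons e h ih =>
    cases e with
    | arrival z => exact ih
    | deadline a =>
      have h1 := hch h ih.1
      cases hc : choice G y W h a with
      | none =>
        have hc' := hc
        rw [h1] at hc'
        rw [free_deadline_none hc, free_deadline_none hc', pairs_deadline_none hc,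
          pairs_deadline_none hc']
        exact ih
      | some c =>
        have hc' := hc
        rw [h1] at hc'
        rw [free_deadline_some hc, free_deadline_some hc', pairs_deadline_some hc,
          pairs_deadline_some hc', ih.1, ih.2]
        exact ⟨rfl, rfl⟩

/-- Raising the rank of a vertex that is never matched does not change the run. -/
theorem free_raise (hx : x ∈ free G y W h) (hy : ∀ a, a ≠ x → y' a = y a) (hxy : y x ≤ y' x) :
    free G y' W h = free G y W h := by
  induction h with
  | nil => rfl
  | cons e h ih =>
    have hx' := free_cons_subset e hx
    cases e with
    | arrival z => exact ih hx'
    | deadline a =>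
      cases hc : choice G y W h a with
      | none =>
        have hc' : choice G y' W h a = none := by
          by_cases ha : a ∈ free G y W h
          · rw [choice_of_mem ha] at hc
            rw [choice_of_mem (by rwa [ih hx']), ih hx']
            exact pick_eq_none fun w hw haw hwS => pick_ne_none hw haw hwS hc
          · exact choice_of_notMem (by rwa [ih hx'])
        rw [free_deadline_none hc, free_deadline_none hc', ih hx']
      | some c =>
        have hcx : c ≠ x := by
          rintro rfl
          rw [free_deadline_some hc] at hx
          exact hx.2 (by simp)
        have hc' : choice G y' W h a = some c := by
          rw [choice_of_mem (by rw [ih hx']; exact mem_free_of_choice hc), ih hx']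
          exact argmin_raise (pick_of_choice hc) hcx hy hxy
        rw [free_deadline_some hc, free_deadline_some hc', ih hx']

/-- Removing a vertex that is never matched does not change the run. -/
theorem free_remove (hx : x ∈ free G y W h) (hd : Event.deadline x ∉ h) :
    free G y (W \ {x}) h = free G y W h \ {x} := by
  induction h with
  | nil => rfl
  | cons e h ih =>
    have hx' := free_cons_subset e hx
    simp only [List.mem_cons, not_or] at hd
    have ih := ih hx' hd.2
    cases e with
    | arrival z => exact ih
    | deadline a =>
      have hax : a ≠ x := fun hh => hd.1 (by rw [hh])
      have hmem : a ∈ free G y (W \ {x}) h ↔ a ∈ free G y W h := by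
        rw [ih]; simp [hax]
      cases hc : choice G y W h a with
      | none =>
        have hc' : choice G y (W \ {x}) h a = none := by
          by_cases ha : a ∈ free G y W h
          · rw [choice_of_mem ha] at hc
            rw [choice_of_mem (hmem.2 ha), ih]
            exact pick_subset_none Set.sdiff_subset hc
          · exact choice_of_notMem (fun hh => ha (hmem.1 hh))
        rw [free_deadline_none hc, free_deadline_none hc', ih]
      | some c =>
        have hcx : c ≠ x := by
          rintro rfl
          rw [free_deadline_some hc] at hx
          exact hx.2 (by simp)
        have hc' : choice G y (W \ {x}) h a = some c := by
          rw [choice_of_mem (hmem.2 (mem_free_of_choice hc)), ih]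
          exact pick_subset Set.sdiff_subset (pick_of_choice hc)
            ⟨(pick_mem (pick_of_choice hc)).2.2, hcx⟩
        rw [free_deadline_some hc, free_deadline_some hc', ih, Set.sdiff_sdiff_comm]

/-- Two sets that differ by at most one element. -/
def AlmostEq (S S' : Set V) : Prop :=
  S = S' ∨ (∃ z ∉ S, S' = insert z S) ∨ ∃ z ∉ S', S = insert z S'

theorem AlmostEq.symm (hS : AlmostEq S S') : AlmostEq S' S := by
  rcases hS with rfl | hS | hS
  · exact Or.inl rfl
  · exact Or.inr (Or.inr hS)
  · exact Or.inr (Or.inl hS)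

theorem almostEq_diff_singleton (S : Set V) (c : V) : AlmostEq S (S \ {c}) := by
  by_cases hc : c ∈ S
  · exact Or.inr (Or.inr ⟨c, by simp, by rw [Set.insert_sdiff_singleton, Set.insert_eq_of_mem hc]⟩)
  · exact Or.inl (by rw [Set.sdiff_singleton_eq_self hc])

theorem almostEq_diff_pair (S : Set V) (a c : V) : AlmostEq (S \ {a}) (S \ {a, c}) := by
  have : S \ {a, c} = (S \ {a}) \ {c} := by
    ext w; simp only [Set.mem_sdiff, Set.mem_insert_iff, Set.mem_singleton_iff]; tauto
  rw [this]
  exact almostEq_diff_singleton _ _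

/-- A deadline turns sets of unmatched vertices that differ by the vertex `z` into sets that
differ by at most one vertex. -/
theorem almostEq_step_aux {z : V} (hz : z ∉ free G y W h)
    (hW : free G y W' h = insert z (free G y W h)) (a : V) :
    AlmostEq (free G y W (.deadline a :: h)) (free G y W' (.deadline a :: h)) := by
  have hsub : free G y W h ⊆ free G y W' h := by rw [hW]; exact Set.subset_insert _ _
  by_cases haz : a = z
  · subst haz
    rw [free_deadline_none (choice_of_notMem hz)]
    cases hc : choice G y W' h a with
    | none =>
      rw [free_deadline_none hc]
      exact Or.inr (Or.inl ⟨a, hz, hW⟩)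
    | some c =>
      have : free G y W' h \ {a, c} = free G y W h \ {c} := by
        rw [hW]; ext w
        simp only [Set.mem_sdiff, Set.mem_insert_iff, Set.mem_singleton_iff]
        constructor
        · tauto
        · rintro ⟨h1, h2⟩
          exact ⟨Or.inr h1, fun hh => hh.elim (fun hh => hz (hh ▸ h1)) h2⟩
      rw [free_deadline_some hc, this]
      exact almostEq_diff_singleton _ _
  · by_cases ha : a ∈ free G y W h
    · cases hc' : choice G y W' h a with
      | none =>
        have hc : choice G y W h a = none := by
          rw [choice_of_mem (hsub ha)] at hc'
          rw [choice_of_mem ha]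
          exact pick_subset_none hsub hc'
        rw [free_deadline_none hc, free_deadline_none hc']
        exact Or.inr (Or.inl ⟨z, hz, hW⟩)
      | some c =>
        by_cases hcz : c = z
        · subst hcz
          have h1 : free G y W' h \ {a, c} = free G y W h \ {a} := by
            rw [hW]; ext w
            simp only [Set.mem_sdiff, Set.mem_insert_iff, Set.mem_singleton_iff]
            constructor
            · tauto
            · rintro ⟨h1, h2⟩
              exact ⟨Or.inr h1, fun hh => hh.elim h2 (fun hh => hz (hh ▸ h1))⟩
          rw [free_deadline_some hc', h1]
          cases hc : choice G y W h a with
          | none =>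
            rw [free_deadline_none hc]
            exact almostEq_diff_singleton _ _
          | some d =>
            rw [free_deadline_some hc]
            exact (almostEq_diff_pair _ _ _).symm
        · have hcm : c ∈ free G y W h := by
            have := (pick_mem (pick_of_choice hc')).2.2
            rw [hW] at this
            exact this.resolve_left hcz
          have hc : choice G y W h a = some c := by
            rw [choice_of_mem ha]
            exact pick_subset hsub (pick_of_choice hc') hcm
          rw [free_deadline_some hc, free_deadline_some hc', hW]
          refine Or.inr (Or.inl ⟨z, fun hh => hz hh.1, ?_⟩)
          rw [Set.insert_sdiff_of_notMem]
          simp only [Set.mem_insert_iff, Set.mem_singleton_iff, not_or]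
          exact ⟨fun hh => haz hh.symm, fun hh => hcz hh.symm⟩
    · have ha' : a ∉ free G y W' h := by
        rw [hW]; simp [haz, ha]
      rw [free_deadline_none (choice_of_notMem ha), free_deadline_none (choice_of_notMem ha')]
      exact Or.inr (Or.inl ⟨z, hz, hW⟩)

/-- Adding or removing one vertex changes the set of unmatched vertices by at most one vertex at
every moment: this is the alternating path argument. -/
theorem almostEq_free (hW : AlmostEq W W') : AlmostEq (free G y W h) (free G y W' h) := by
  induction h with
  | nil => exact hW
  | cons e h ih =>
    cases e with
    | arrival x => exact ih
    | deadline a =>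
      rcases ih with ih | ⟨z, hz, ih⟩ | ⟨z, hz, ih⟩
      · left
        have hc : choice G y W h a = choice G y W' h a := by unfold choice; rw [ih]
        cases hc' : choice G y W' h a with
        | none => rw [free_deadline_none hc', free_deadline_none (hc.trans hc'), ih]
        | some c => rw [free_deadline_some hc', free_deadline_some (hc.trans hc'), ih]
      · exact almostEq_step_aux hz ih a
      · exact (almostEq_step_aux hz ih a).symm

end Run

/-! ### Thresholds of a removed edge -/

section Threshold

variable {V : Type*} {G : SimpleGraph V} {y y' : V → ℝ} {W : Set V} {h : List (Event V)}
  {a c u v w x z : V}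

open Classical in
/-- The rank below which `x`, although not available itself, would be preferred by `a` at its
deadline right after `h`: it is the rank of the partner of `a`, it is `1` if `a` finds no partner,
and it is `0` if `a` cannot be matched to `x` at all. -/
noncomputable def bid (G : SimpleGraph V) (y : V → ℝ) (W : Set V) (x : V) (h : List (Event V))
    (a : V) : ℝ :=
  if a ∈ free G y W h ∧ x ∈ arrivals h ∧ G.Adj a x then
    match choice G y W h a with
    | none => 1
    | some c => y c
  else 0

/-- The threshold of `x`: if `x` were added to a run in which only the vertices of `W` are
available, some active vertex would choose `x` exactly when the rank of `x` is below it. -/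
noncomputable def thr (G : SimpleGraph V) (y : V → ℝ) (W : Set V) (x : V) : List (Event V) → ℝ
  | [] => 0
  | .arrival _ :: h => thr G y W x h
  | .deadline a :: h => max (thr G y W x h) (bid G y W x h a)

theorem thr_nonneg : 0 ≤ thr G y W x h := by
  induction h with
  | nil => exact le_rfl
  | cons e h ih =>
    cases e with
    | arrival z => exact ih
    | deadline a => exact ih.trans (le_max_left _ _)

theorem bid_le_one (hy : ∀ w, y w ≤ 1) : bid G y W x h a ≤ 1 := by
  unfold bid
  split_ifs
  · split
    · exact le_rfl
    · exact hy _
  · exact zero_le_one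

theorem thr_le_one (hy : ∀ w, y w ≤ 1) : thr G y W x h ≤ 1 := by
  induction h with
  | nil => exact zero_le_one
  | cons e h ih =>
    cases e with
    | arrival z => exact ih
    | deadline a => exact max_le ih (bid_le_one hy)

theorem choice_congr (hy : ∀ w ∈ W, y w = y' w) : choice G y W h a = choice G y' W h a := by
  have hy' : ∀ a ∈ W, ∀ b ∈ W, (y a ≤ y b ↔ y' a ≤ y' b) := fun a ha b hb => by
    rw [hy a ha, hy b hb]
  unfold choice
  rw [(run_congr_order hy').1,
    pick_congr_order fun a ha b hb => hy' a (free_subset _ ha) b (free_subset _ hb)]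

theorem free_congr (hy : ∀ w ∈ W, y w = y' w) : free G y W h = free G y' W h :=
  (run_congr_order fun a ha b hb => by rw [hy a ha, hy b hb]).1

theorem thr_congr (hy : ∀ w ∈ W, y w = y' w) : thr G y W x h = thr G y' W x h := by
  induction h with
  | nil => rfl
  | cons e h ih =>
    cases e with
    | arrival z => exact ih
    | deadline a =>
      have : bid G y W x h a = bid G y' W x h a := by
        unfold bid
        rw [free_congr hy, ← choice_congr hy]
        split_ifs
        · cases hc : choice G y W h a with
          | none => rfl
          | some c => exact hy c (free_subset _ (pick_mem (pick_of_choice hc)).2.2)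
        · rfl
      rw [thr, thr, ih, this]

/-- Raising the rank of a vertex that is never matched does not change the thresholds. -/
theorem thr_raise (hx : x ∈ free G y W h) (hy : ∀ a, a ≠ x → y' a = y a) (hxy : y x ≤ y' x) :
    thr G y' W z h = thr G y W z h := by
  induction h with
  | nil => rfl
  | cons e h ih =>
    have hx' := free_cons_subset e hx
    cases e with
    | arrival z => exact ih hx'
    | deadline a =>
      have hf : free G y' W h = free G y W h := free_raise hx' hy hxy
      have : bid G y' W z h a = bid G y W z h a := by
        unfold bid
        rw [hf]
        by_cases ha : a ∈ free G y W h
        · cases hc : choice G y W h a with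
          | none =>
            have hc' : choice G y' W h a = none := by
              rw [choice_of_mem ha] at hc
              rw [choice_of_mem (by rwa [hf]), hf]
              exact pick_eq_none fun w hw haw hwS => pick_ne_none hw haw hwS hc
            rw [hc']
          | some c =>
            have hcx : c ≠ x := by
              rintro rfl
              rw [free_deadline_some hc] at hx
              exact hx.2 (by simp)
            have hc' : choice G y' W h a = some c := by
              rw [choice_of_mem (by rwa [hf]), hf]
              exact argmin_raise (pick_of_choice hc) hcx hy hxy
            rw [hc']
            simp only [hy c hcx]
        · simp [ha]
      rw [thr, thr, ih hx', this]

/-- Comparison of the full run with the run in which `u` and `v` are not available, as long as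
neither of the two deadlines has been reached: either `u` and `v` are both above their thresholds
and the two runs agree, or one of them is below its threshold and gets matched passively. -/
theorem run_dichotomy (hu0 : 0 ≤ y u) (hv0 : 0 ≤ y v) (hu1 : y u ≤ 1) (hv1 : y v ≤ 1)
    (hu : Event.deadline u ∉ h) (hv : Event.deadline v ∉ h) :
    (free G y Set.univ h = free G y {u, v}ᶜ h ∪ {u, v} ∧
        thr G y {u, v}ᶜ u h ≤ y u ∧ thr G y {u, v}ᶜ v h ≤ y v) ∨
      ((∃ a, (a, u) ∈ pairs G y Set.univ h) ∧ y u ≤ thr G y {u, v}ᶜ u h) ∨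
      ((∃ a, (a, v) ∈ pairs G y Set.univ h) ∧ y v ≤ thr G y {u, v}ᶜ v h) := by
  induction h with
  | nil => exact Or.inl ⟨by rw [free_nil, free_nil, Set.compl_union_self], hu0, hv0⟩
  | cons e h ih =>
    simp only [List.mem_cons, not_or] at hu hv
    have hmono : ∀ x, thr G y {u, v}ᶜ x h ≤ thr G y {u, v}ᶜ x (e :: h) := by
      intro x
      cases e with
      | arrival z => exact le_rfl
      | deadline a => exact le_max_left _ _
    have hpairs : pairs G y Set.univ h ⊆ pairs G y Set.univ (e :: h) := pairs_subset_append [e]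
    rcases ih hu.2 hv.2 with ⟨hf, htu, htv⟩ | ⟨⟨a, ha⟩, ht⟩ | ⟨⟨a, ha⟩, ht⟩
    · cases e with
      | arrival z => exact Or.inl ⟨hf, htu, htv⟩
      | deadline a =>
        have hau : a ≠ u := fun hh => hu.1 (by rw [hh])
        have hav : a ≠ v := fun hh => hv.1 (by rw [hh])
        have hsub : free G y {u, v}ᶜ h ⊆ free G y Set.univ h := by
          rw [hf]; exact Set.subset_union_left
        have hmem : a ∈ free G y Set.univ h ↔ a ∈ free G y {u, v}ᶜ h := by
          rw [hf]; simp [hau, hav]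
        have huf : u ∈ free G y Set.univ h := by rw [hf]; simp
        have hvf : v ∈ free G y Set.univ h := by rw [hf]; simp
        by_cases haf : a ∈ free G y {u, v}ᶜ h
        · cases hc : choice G y Set.univ h a with
          | none =>
            -- `u` and `v` are unmatched, so they are not arrived neighbors of `a` and bid nothing.
            have hc0 := hc
            rw [choice_of_mem (hmem.2 haf)] at hc
            have hc' : choice G y {u, v}ᶜ h a = none := by
              rw [choice_of_mem haf]; exact pick_subset_none hsub hc
            have hb : ∀ x, x ∈ free G y Set.univ h → bid G y {u, v}ᶜ x h a = 0 := by
              intro x hx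
              unfold bid
              rw [if_neg]
              rintro ⟨-, h1, h2⟩
              exact pick_ne_none h1 h2 hx hc
            refine Or.inl ⟨?_, ?_, ?_⟩
            · rw [free_deadline_none hc0, free_deadline_none hc', hf]
            · rw [thr, hb u huf]; exact max_le htu hu0
            · rw [thr, hb v hvf]; exact max_le htv hv0
          | some c =>
            have hp := pick_of_choice hc
            obtain ⟨hcL, hac, hcf⟩ := pick_mem hp
            have hmp : (a, c) ∈ pairs G y Set.univ (.deadline a :: h) := by
              rw [pairs_deadline_some hc]; exact List.mem_cons_self
            -- If `c` is `u` or `v`, it is at least as good as the partner of `a` in the other run.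
            have hbid : y c ≤ 1 → y c ≤ bid G y {u, v}ᶜ c h a := by
              intro hc1
              unfold bid
              rw [if_pos ⟨haf, hcL, hac⟩]
              cases hd : choice G y {u, v}ᶜ h a with
              | none => exact hc1
              | some d =>
                obtain ⟨h1, h2, h3⟩ := pick_mem (pick_of_choice hd)
                exact pick_le hp h1 h2 (hsub h3)
            by_cases hcu : c = u
            · subst hcu
              exact Or.inr (Or.inl ⟨⟨a, hmp⟩, (hbid hu1).trans (le_max_right _ _)⟩)
            by_cases hcv : c = v
            · subst hcv
              exact Or.inr (Or.inr ⟨⟨a, hmp⟩, (hbid hv1).trans (le_max_right _ _)⟩)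
            have hc0 : c ∈ free G y {u, v}ᶜ h := by
              rw [hf] at hcf
              rcases hcf with hcf | hcf
              · exact hcf
              · simp [hcu, hcv] at hcf
            have hc' : choice G y {u, v}ᶜ h a = some c := by
              rw [choice_of_mem haf]; exact pick_subset hsub hp hc0
            have hb : ∀ x, 0 ≤ y x → x ∈ free G y Set.univ h → bid G y {u, v}ᶜ x h a ≤ y x := by
              intro x hx0 hx
              unfold bid
              rw [hc']
              split_ifs with hh
              · exact pick_le hp hh.2.1 hh.2.2 hx
              · exact hx0
            refine Or.inl ⟨?_, max_le htu (hb u hu0 huf), max_le htv (hb v hv0 hvf)⟩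
            rw [free_deadline_some hc, free_deadline_some hc', hf, Set.union_sdiff_distrib]
            congr 1
            ext w
            simp only [Set.mem_sdiff, Set.mem_insert_iff, Set.mem_singleton_iff]
            constructor
            · tauto
            · rintro (rfl | rfl)
              · exact ⟨Or.inl rfl, fun hh =>
                  hh.elim (fun hh => hau hh.symm) (fun hh => hcu hh.symm)⟩
              · exact ⟨Or.inr rfl, fun hh =>
                  hh.elim (fun hh => hav hh.symm) (fun hh => hcv hh.symm)⟩
        · have hb : ∀ x, bid G y {u, v}ᶜ x h a = 0 := by
            intro x
            unfold bid
            rw [if_neg fun hh => haf hh.1]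
          refine Or.inl ⟨?_, ?_, ?_⟩
          · rw [free_deadline_none (choice_of_notMem haf),
              free_deadline_none (choice_of_notMem fun hh => haf (hmem.1 hh)), hf]
          · rw [thr, hb]; exact max_le htu hu0
          · rw [thr, hb]; exact max_le htv hv0
    · exact Or.inr (Or.inl ⟨⟨a, hpairs ha⟩, ht.trans (hmono u)⟩)
    · exact Or.inr (Or.inr ⟨⟨a, hpairs ha⟩, ht.trans (hmono v)⟩)

end Threshold

/-! ### Gain sharing -/

/-- The unit step at `c`. -/
noncomputable def step (c t : ℝ) : ℝ := if c ≤ t then 1 else 0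

/-- The share of a matched edge that goes to its passive endpoint, of rank `t`; the active endpoint
receives the rest. The breakpoints and the values `0.46`, `0.51`, `0.58` are chosen so that the
inequalities `bound_no_spare`, `bound_one_spare` and `bound_two_spare` hold. -/
noncomputable def share (t : ℝ) : ℝ :=
  46 / 100 * step 0 t + 5 / 100 * step (1 / 8) t + 7 / 100 * step (1 / 4) t

theorem step_nonneg (c t : ℝ) : 0 ≤ step c t := by unfold step; split_ifs <;> norm_num

theorem step_le_one (c t : ℝ) : step c t ≤ 1 := by unfold step; split_ifs <;> norm_num

theorem step_mono (c : ℝ) : Monotone (step c) := by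
  intro s t hst
  unfold step
  split_ifs with h1 h2
  · exact le_rfl
  · exact absurd (h1.trans hst) h2
  · exact zero_le_one
  · exact le_rfl

theorem share_nonneg (t : ℝ) : 0 ≤ share t := by
  unfold share
  linarith [step_nonneg 0 t, step_nonneg (1 / 8) t, step_nonneg (1 / 4) t]

theorem share_le (t : ℝ) : share t ≤ 58 / 100 := by
  unfold share
  linarith [step_le_one 0 t, step_le_one (1 / 8) t, step_le_one (1 / 4) t]

theorem share_mono : Monotone share := by
  intro s t hst
  unfold share
  linarith [step_mono 0 hst, step_mono (1 / 8) hst, step_mono (1 / 4) hst]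

theorem le_share {t : ℝ} (ht : 0 ≤ t) : 46 / 100 ≤ share t := by
  have : step 0 t = 1 := if_pos ht
  unfold share
  linarith [step_nonneg (1 / 8) t, step_nonneg (1 / 4) t]

section Gain

variable {V : Type*} {G : SimpleGraph V} {y : V → ℝ} {h H : List (Event V)} {a c u v w : V}

/-- The neighbors of `u` that have arrived and are unmatched after `h` when `u` and `v` are not
available. -/
def spare (G : SimpleGraph V) (u v : V) (h : List (Event V)) (y : V → ℝ) : Set V :=
  {w | w ∈ arrivals h ∧ G.Adj u w ∧ w ∈ free G y {u, v}ᶜ h}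

/-- The situation at the deadline of `u`, the endpoint of the edge `uv` with the earlier deadline:
`h` is the history before that deadline. -/
structure Critical (G : SimpleGraph V) (H : List (Event V)) (u v : V) (h : List (Event V)) :
    Prop where
  exists_append : ∃ h', H = h' ++ .deadline u :: h
  adj : G.Adj u v
  arrived : v ∈ arrivals h
  first_notMem : Event.deadline u ∉ h
  second_notMem : Event.deadline v ∉ h

namespace Critical

theorem pairs_subset' (hC : Critical G H u v h) :
    pairs G y Set.univ (.deadline u :: h) ⊆ pairs G y Set.univ H := by
  obtain ⟨h', rfl⟩ := hC.exists_append
  exact pairs_subset_append h'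

theorem pairs_subset (hC : Critical G H u v h) :
    pairs G y Set.univ h ⊆ pairs G y Set.univ H :=
  List.Subset.trans (pairs_subset_append [Event.deadline u]) hC.pairs_subset'

end Critical

variable [Fintype V]

open Classical in
/-- The gain of the vertex `w` in the run of Ranking over the history `h`. -/
noncomputable def gain (G : SimpleGraph V) (h : List (Event V)) (w : V) (y : V → ℝ) : ℝ :=
  (∑ c, if (w, c) ∈ pairs G y Set.univ h then 1 - share (y c) else 0) +
    ∑ a, if (a, w) ∈ pairs G y Set.univ h then share (y w) else 0

open Classical in
theorem gain_parts_nonneg :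
    (∀ c ∈ Finset.univ, 0 ≤ (if (w, c) ∈ pairs G y Set.univ h then 1 - share (y c) else 0)) ∧
      ∀ a ∈ Finset.univ, 0 ≤ (if (a, w) ∈ pairs G y Set.univ h then share (y w) else 0) := by
  constructor
  · intro c _
    split_ifs
    · linarith [share_le (y c)]
    · exact le_rfl
  · intro a _
    split_ifs
    · exact share_nonneg _
    · exact le_rfl

theorem gain_nonneg : 0 ≤ gain G h w y := by
  unfold gain
  exact add_nonneg (Finset.sum_nonneg gain_parts_nonneg.1) (Finset.sum_nonneg gain_parts_nonneg.2)

open Classical in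
theorem le_gain_active (hp : (w, c) ∈ pairs G y Set.univ h) : 1 - share (y c) ≤ gain G h w y := by
  have h1 := Finset.single_le_sum (gain_parts_nonneg (G := G) (y := y) (h := h) (w := w)).1
    (Finset.mem_univ c)
  have h2 := Finset.sum_nonneg (gain_parts_nonneg (G := G) (y := y) (h := h) (w := w)).2
  rw [if_pos hp] at h1
  unfold gain
  linarith

open Classical in
theorem le_gain_passive (hp : (a, w) ∈ pairs G y Set.univ h) : share (y w) ≤ gain G h w y := by
  have h1 := Finset.sum_nonneg (gain_parts_nonneg (G := G) (y := y) (h := h) (w := w)).1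
  have h2 := Finset.single_le_sum (gain_parts_nonneg (G := G) (y := y) (h := h) (w := w)).2
    (Finset.mem_univ a)
  rw [if_pos hp] at h2
  unfold gain
  linarith

/-- The two endpoints of a matched edge share a total gain of `1`. -/
theorem sum_gain_le : ∑ w, gain G h w y ≤ (pairs G y Set.univ h).length := by
  classical
  have : ∑ w, gain G h w y =
      ∑ p : V × V, if p ∈ pairs G y Set.univ h then (1 : ℝ) else 0 := by
    unfold gain
    rw [Finset.sum_add_distrib, Finset.sum_comm (γ := V) (α := V)
      (f := fun w a => if (a, w) ∈ pairs G y Set.univ h then share (y w) else 0),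
      ← Finset.sum_add_distrib, Fintype.sum_prod_type]
    refine Finset.sum_congr rfl fun a _ => ?_
    rw [← Finset.sum_add_distrib]
    refine Finset.sum_congr rfl fun c _ => ?_
    split_ifs <;> ring
  rw [this, Finset.sum_boole]
  have h2 : Finset.univ.filter (fun p : V × V => p ∈ pairs G y Set.univ h) =
      (pairs G y Set.univ h).toFinset := by ext; simp
  rw [h2]
  exact_mod_cast List.toFinset_card_le _

theorem gain_le : gain G h w y ≤ 2 * Fintype.card V := by
  classical
  unfold gain
  have h1 : ∀ c ∈ Finset.univ,
      (if (w, c) ∈ pairs G y Set.univ h then 1 - share (y c) else 0) ≤ 1 := by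
    intro c _
    split_ifs
    · linarith [share_nonneg (y c)]
    · exact zero_le_one
  have h2 : ∀ a ∈ Finset.univ,
      (if (a, w) ∈ pairs G y Set.univ h then share (y w) else 0) ≤ 1 := by
    intro c _
    split_ifs
    · linarith [share_le (y w)]
    · exact zero_le_one
  have h1 := Finset.sum_le_sum h1
  have h2 := Finset.sum_le_sum h2
  simp only [Finset.sum_const, Finset.card_univ, nsmul_eq_mul, mul_one] at h1 h2
  linarith

namespace Critical

/-- If both ranks are above the thresholds, `u` is matched at its deadline to the better one of `v`
and the best spare neighbor. -/
theorem gain_clean (hC : Critical G H u v h) (hy : ∀ w, 0 ≤ y w ∧ y w ≤ 1) {ρ : ℝ}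
    (hρ : ∀ w ∈ spare G u v h y, ρ ≤ y w)
    (hρ' : ρ = 1 ∨ ∃ w ∈ spare G u v h y, y w = ρ)
    (hu : thr G y {u, v}ᶜ u h < y u) (hv : thr G y {u, v}ᶜ v h < y v) :
    1 - share ρ + (if y v < ρ then share ρ else 0) ≤ gain G H u y + gain G H v y := by
  rcases run_dichotomy (h := h) (G := G) (hy u).1 (hy v).1 (hy u).2 (hy v).2 hC.first_notMem
    hC.second_notMem with ⟨hf, -, -⟩ | ⟨-, hh⟩ | ⟨-, hh⟩
  · have huf : u ∈ free G y Set.univ h := by rw [hf]; simp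
    have hvf : v ∈ free G y Set.univ h := by rw [hf]; simp
    have hgv : 0 ≤ gain G H v y := gain_nonneg
    cases hc : choice G y Set.univ h u with
    | none =>
      rw [choice_of_mem huf] at hc
      exact absurd hc (pick_ne_none hC.arrived hC.adj hvf)
    | some c =>
      have hp := pick_of_choice hc
      obtain ⟨hcL, huc, hcf⟩ := pick_mem hp
      have hmem : (u, c) ∈ pairs G y Set.univ H := hC.pairs_subset' (by
        rw [pairs_deadline_some hc]; exact List.mem_cons_self)
      have hgu := le_gain_active hmem
      by_cases hcv : c = v
      · subst hcv
        have := le_gain_passive hmem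
        have h3 := share_nonneg ρ
        split_ifs <;> linarith
      · have hcs : c ∈ spare G u v h y := by
          refine ⟨hcL, huc, ?_⟩
          rw [hf] at hcf
          rcases hcf with hcf | hcf
          · exact hcf
          · simp only [Set.mem_insert_iff, Set.mem_singleton_iff] at hcf
            rcases hcf with rfl | hcf
            · exact absurd huc G.irrefl
            · exact absurd hcf hcv
        have hcv' : y c ≤ y v := pick_le hp hC.arrived hC.adj hvf
        have hcρ : y c ≤ ρ := by
          rcases hρ' with rfl | ⟨w, hw, rfl⟩
          · exact (hy c).2
          · refine pick_le hp hw.1 hw.2.1 ?_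
            rw [hf]; exact Or.inl hw.2.2
        rw [if_neg (by linarith [hρ c hcs])]
        linarith [share_mono hcρ]
  · linarith
  · linarith

/-- If only `u` is below its threshold, `u` is matched passively. -/
theorem gain_first (hC : Critical G H u v h) (hy : ∀ w, 0 ≤ y w ∧ y w ≤ 1)
    (hu : y u < thr G y {u, v}ᶜ u h) (hv : thr G y {u, v}ᶜ v h < y v) :
    share (y u) ≤ gain G H u y + gain G H v y := by
  have hgv : 0 ≤ gain G H v y := gain_nonneg
  rcases run_dichotomy (h := h) (G := G) (hy u).1 (hy v).1 (hy u).2 (hy v).2 hC.first_notMem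
    hC.second_notMem with ⟨-, hh, -⟩ | ⟨⟨a, ha⟩, -⟩ | ⟨-, hh⟩
  · linarith
  · linarith [le_gain_passive (hC.pairs_subset ha)]
  · linarith

/-- If `u` and `v` are below their thresholds, one of them is matched passively. -/
theorem gain_both (hC : Critical G H u v h) (hy : ∀ w, 0 ≤ y w ∧ y w ≤ 1)
    (hu : y u < thr G y {u, v}ᶜ u h) :
    min (share (y u)) (share (y v)) ≤ gain G H u y + gain G H v y := by
  have hgu : 0 ≤ gain G H u y := gain_nonneg
  have hgv : 0 ≤ gain G H v y := gain_nonneg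
  rcases run_dichotomy (h := h) (G := G) (hy u).1 (hy v).1 (hy u).2 (hy v).2 hC.first_notMem
    hC.second_notMem with ⟨-, hh, -⟩ | ⟨⟨a, ha⟩, -⟩ | ⟨⟨a, ha⟩, -⟩
  · linarith
  · linarith [le_gain_passive (hC.pairs_subset ha), min_le_left (share (y u)) (share (y v))]
  · linarith [le_gain_passive (hC.pairs_subset ha), min_le_right (share (y u)) (share (y v))]

/-- If only `v` is below its threshold, `v` is matched passively. If `u` moreover has two spare
neighbors, at most one of them is lost when `v` joins the run, so `u` is matched as well. -/
theorem gain_second (hC : Critical G H u v h) (hy : ∀ w, 0 ≤ y w ∧ y w ≤ 1)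
    (hu : thr G y {u, v}ᶜ u h < y u) (hv : y v < thr G y {u, v}ᶜ v h) :
    share (y v) ≤ gain G H u y + gain G H v y ∧
      ((spare G u v h y).Nontrivial →
        share (y v) + 42 / 100 ≤ gain G H u y + gain G H v y) := by
  have hgu : 0 ≤ gain G H u y := gain_nonneg
  rcases run_dichotomy (h := h) (G := G) (hy u).1 (hy v).1 (hy u).2 (hy v).2 hC.first_notMem
    hC.second_notMem with ⟨-, -, hh⟩ | ⟨-, hh⟩ | ⟨⟨a, ha⟩, -⟩
  · linarith
  · linarith
  · have hgv := le_gain_passive (hC.pairs_subset ha)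
    refine ⟨by linarith, fun hs => ?_⟩
    suffices 42 / 100 ≤ gain G H u y by linarith
    by_cases huf : u ∈ free G y Set.univ h
      -- The run without `u` and the run without `u` and `v` differ by at most one vertex, so one of
      -- two spare neighbors is still available at the deadline of `u`.
    · have hne : choice G y Set.univ h u ≠ none := by
        rw [choice_of_mem huf]
        have h1 : AlmostEq (free G y (Set.univ \ {u}) h) (free G y {u, v}ᶜ h) := by
          have := almostEq_free (G := G) (y := y) (h := h) (almostEq_diff_pair Set.univ u v)
          rwa [← Set.compl_eq_univ_sdiff {u, v}] at this
        rw [free_remove huf hC.first_notMem] at h1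
        obtain ⟨w1, hw1, w2, hw2, hne⟩ := hs
        have key : w1 ∈ free G y Set.univ h ∨ w2 ∈ free G y Set.univ h := by
          rcases h1 with h1 | ⟨z, -, h1⟩ | ⟨z, -, h1⟩
          · left
            have := hw1.2.2
            rw [← h1] at this
            exact this.1
          · by_cases hz : w1 = z
            · right
              have := hw2.2.2
              rw [h1] at this
              exact (this.resolve_left fun hh => hne (hz.trans hh.symm)).1
            · left
              have := hw1.2.2
              rw [h1] at this
              exact (this.resolve_left hz).1
          · left
            have : w1 ∈ free G y Set.univ h \ {u} := by rw [h1]; exact Or.inr hw1.2.2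
            exact this.1
        rcases key with hk | hk
        · exact pick_ne_none hw1.1 hw1.2.1 hk
        · exact pick_ne_none hw2.1 hw2.2.1 hk
      obtain ⟨c, hc⟩ := Option.ne_none_iff_exists'.1 hne
      have hmem : (u, c) ∈ pairs G y Set.univ H := hC.pairs_subset' (by
        rw [pairs_deadline_some hc]; exact List.mem_cons_self)
      linarith [le_gain_active hmem, share_le (y c)]
    · obtain ⟨c, hc | hc⟩ := exists_pair_of_notMem_free (Set.mem_univ u) huf
      · exact absurd (exists_deadline_of_mem_pairs hc) hC.first_notMem
      · linarith [le_gain_passive (hC.pairs_subset hc), le_share (hy u).1]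

end Critical

end Gain

/-! ### The runs of the algorithm -/

section Algorithm

variable {V : Type*} {G : SimpleGraph V} {y : V → ℝ} {h : List (Event V)} {s : State V}

/-- The state `s` of the algorithm agrees with the history `h`, and it records a matching. -/
structure Agrees (G : SimpleGraph V) (y : V → ℝ) (h : List (Event V)) (s : State V) : Prop where
  arrived_eq : s.arrived = arrivals h
  isMatched_iff : ∀ w, s.IsMatched w ↔ w ∉ free G y Set.univ h
  card_eq : s.matching.card = (pairs G y Set.univ h).length
  edges : ∀ e ∈ s.matching, e ∈ G.edgeSet
  disjoint : ∀ e ∈ s.matching, ∀ e' ∈ s.matching, ∀ w ∈ e, w ∈ e' → e = e'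

theorem Agrees.rankingStep (hs : Agrees G y h s) (e : Event V) :
    Agrees G y (e :: h) (rankingStep G y s e) := by
  classical
  cases e with
  | arrival v =>
    exact ⟨by rw [arrivals, ← hs.arrived_eq]; rfl, hs.isMatched_iff, hs.card_eq, hs.edges,
      hs.disjoint⟩
  | deadline a =>
    by_cases ha : s.IsMatched a
    · have hc : choice G y Set.univ h a = none := choice_of_notMem ((hs.isMatched_iff a).1 ha)
      have : FullyOnlineMatching.rankingStep G y s (.deadline a) = s := by
        simp [FullyOnlineMatching.rankingStep, ha]
      rw [this]
      exact ⟨hs.arrived_eq, by rw [free_deadline_none hc]; exact hs.isMatched_iff,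
        by rw [pairs_deadline_none hc]; exact hs.card_eq, hs.edges, hs.disjoint⟩
    · have haf : a ∈ free G y Set.univ h := by
        by_contra hh; exact ha ((hs.isMatched_iff a).2 hh)
      have hpick : (s.arrived.filter (fun u => G.Adj a u ∧ ¬ s.IsMatched u)).argmin y =
          choice G y Set.univ h a := by
        rw [choice_of_mem haf, pick, hs.arrived_eq]
        congr 1
        apply List.filter_congr
        intro w _
        simp [hs.isMatched_iff w]
      cases hc : choice G y Set.univ h a with
      | none =>
        have : FullyOnlineMatching.rankingStep G y s (.deadline a) = s := by
          rw [FullyOnlineMatching.rankingStep, if_neg ha, hpick, hc]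
        rw [this]
        exact ⟨hs.arrived_eq, by rw [free_deadline_none hc]; exact hs.isMatched_iff,
          by rw [pairs_deadline_none hc]; exact hs.card_eq, hs.edges, hs.disjoint⟩
      | some c =>
        have : FullyOnlineMatching.rankingStep G y s (.deadline a) =
            { s with matching := insert s(a, c) s.matching } := by
          rw [FullyOnlineMatching.rankingStep, if_neg ha, hpick, hc]
        rw [this]
        obtain ⟨-, hac, hcf⟩ := pick_mem (pick_of_choice hc)
        have hcm : ¬ s.IsMatched c := fun hh => (hs.isMatched_iff c).1 hh hcf
        have hnew : ∀ e ∈ s.matching, ∀ w ∈ e, w ∉ s(a, c) := by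
          intro e he w hw hw'
          rcases Sym2.mem_iff.1 hw' with rfl | rfl
          · exact ha ⟨e, he, hw⟩
          · exact hcm ⟨e, he, hw⟩
        refine ⟨hs.arrived_eq, fun w => ?_, ?_, ?_, ?_⟩
        · rw [free_deadline_some hc]
          have := hs.isMatched_iff w
          simp only [State.IsMatched, Finset.mem_insert] at this ⊢
          simp only [Set.mem_sdiff, Set.mem_insert_iff, Set.mem_singleton_iff, not_and, not_not]
          constructor
          · rintro ⟨e, rfl | he, hw⟩ hwf
            · exact Sym2.mem_iff.1 hw
            · exact absurd hwf (this.1 ⟨e, he, hw⟩)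
          · intro hh
            by_cases hwf : w ∈ free G y Set.univ h
            · exact ⟨_, Or.inl rfl, Sym2.mem_iff.2 (hh hwf)⟩
            · obtain ⟨e, he, hw⟩ := this.2 hwf
              exact ⟨e, Or.inr he, hw⟩
        · rw [pairs_deadline_some hc, List.length_cons, ← hs.card_eq]
          exact Finset.card_insert_of_notMem fun hh => ha ⟨_, hh, Sym2.mem_mk_left _ _⟩
        · intro e he
          rcases Finset.mem_insert.1 he with rfl | he
          · exact hac
          · exact hs.edges e he
        · intro e he e' he' w hw hw'
          rcases Finset.mem_insert.1 he with rfl | he <;>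
            rcases Finset.mem_insert.1 he' with rfl | he'
          · rfl
          · exact absurd hw (hnew e' he' w hw')
          · exact absurd hw' (hnew e he w hw)
          · exact hs.disjoint e he e' he' w hw hw'

theorem agrees_foldr (G : SimpleGraph V) (y : V → ℝ) (h : List (Event V)) :
    Agrees G y h (h.foldr (fun e s => rankingStep G y s e) ⟨[], ∅⟩) := by
  induction h with
  | nil =>
    exact ⟨rfl, by simp [State.IsMatched, free_nil], rfl, by simp, by simp⟩
  | cons e h ih => exact ih.rankingStep e

variable (I : Instance V)

theorem Instance.agrees_ranking (y : V → ℝ) :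
    ∃ s : State V, s.matching = I.ranking y ∧ Agrees I.graph y I.timeline.reverse s := by
  refine ⟨_, ?_, agrees_foldr I.graph y I.timeline.reverse⟩
  rw [List.foldr_reverse]
  rfl

theorem Instance.card_ranking (y : V → ℝ) :
    (I.ranking y).card = (pairs I.graph y Set.univ I.timeline.reverse).length := by
  obtain ⟨s, hs, hA⟩ := I.agrees_ranking y
  rw [← hs, hA.card_eq]

theorem Instance.exists_isMatching (y : V → ℝ) :
    ∃ M : I.graph.Subgraph, M.IsMatching ∧ M.edgeSet = (I.ranking y : Set (Sym2 V)) := by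
  obtain ⟨s, hs, hA⟩ := I.agrees_ranking y
  rw [← hs]
  refine ⟨{ verts := {w | s.IsMatched w}
            Adj := fun a b => s(a, b) ∈ s.matching
            adj_sub := fun {a b} hab => hA.edges _ hab
            edge_vert := fun {a b} hab => ⟨_, hab, Sym2.mem_mk_left _ _⟩
            symm := ⟨fun a b hab => by rwa [Sym2.eq_swap]⟩ }, ?_, ?_⟩
  · rintro w ⟨e, he, hw⟩
    obtain ⟨b, rfl⟩ := Sym2.mem_iff_exists.1 hw
    refine ⟨b, he, fun c hc => ?_⟩
    have := hA.disjoint _ he _ hc w hw (Sym2.mem_mk_left _ _)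
    exact (Sym2.congr_right.1 this).symm
  · ext e
    induction e with
    | _ a b => simp [SimpleGraph.Subgraph.mem_edgeSet]

theorem mem_arrivals {v : V} : v ∈ arrivals h ↔ Event.arrival v ∈ h := by
  induction h with
  | nil => simp [arrivals]
  | cons e h ih => cases e <;> simp [arrivals, ih, or_comm]

/-- For every edge, one of its endpoints has the earlier deadline. -/
theorem Instance.exists_critical {u v : V} (huv : I.graph.Adj u v) :
    (∃ h, Critical I.graph I.timeline.reverse u v h) ∨
      ∃ h, Critical I.graph I.timeline.reverse v u h := by
  have key : ∀ u v : V, I.graph.Adj u v → ∀ l₁ l₂, I.timeline = l₁ ++ .deadline u :: l₂ →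
      Event.deadline v ∉ l₁ → Critical I.graph I.timeline.reverse u v l₁.reverse := by
    intro u v huv l₁ l₂ hl hv
    have hnd := I.nodup
    rw [hl, List.nodup_append] at hnd
    have hnd2 := (List.nodup_cons.1 hnd.2.1).1
    refine ⟨⟨l₂.reverse, by simp [hl]⟩, huv, ?_, ?_, by simpa using hv⟩
    · rw [mem_arrivals, List.mem_reverse]
      have hsub := I.neighbor_arrival_before_deadline v u huv.symm
      rw [hl] at hsub
      by_contra hcon
      obtain ⟨r₁, r₂, hr, h1, h2⟩ := List.sublist_append_iff.1 hsub
      have hr1 : r₁ = [] := by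
        cases r₁ with
        | nil => rfl
        | cons e r =>
          rw [List.cons_append, List.cons.injEq] at hr
          exact absurd (h1.subset (by rw [hr.1]; simp)) hcon
      subst hr1
      rw [List.nil_append] at hr
      subst hr
      have h3 := (List.sublist_cons_iff.1 h2)
      rcases h3 with h3 | ⟨r, h3, h4⟩
      · exact hnd2 (h3.subset (by simp))
      · simp at h3
    · rw [List.mem_reverse]
      exact fun hh => hnd.2.2 _ hh _ List.mem_cons_self rfl
  obtain ⟨l₁, l₂, hl⟩ := List.append_of_mem (I.complete (.deadline u))
  by_cases hv : Event.deadline v ∈ l₁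
  · right
    obtain ⟨k₁, k₂, hk⟩ := List.append_of_mem hv
    refine ⟨_, key v u huv.symm k₁ (k₂ ++ .deadline u :: l₂) (by rw [hl, hk]; simp) fun hh => ?_⟩
    have hnd := I.nodup
    rw [hl, List.nodup_append] at hnd
    exact hnd.2.2 (.deadline u) (by rw [hk]; simp [hh]) _ List.mem_cons_self rfl
  · exact Or.inl ⟨_, key u v huv l₁ l₂ hl hv⟩

end Algorithm

/-! ### Numerical inequalities -/

/-- The length of the interval from `c` to `s`. -/
noncomputable def cap (c s : ℝ) : ℝ := max (s - c) 0

/-- The expected gain on the three regions in which at least one of two uniform ranks is below its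
threshold, `s` and `b` respectively. -/
noncomputable def base (s b : ℝ) : ℝ :=
  46 / 100 * (cap 0 s * cap 0 b + cap 0 s * (1 - b) + (1 - s) * cap 0 b) +
  5 / 100 * (cap (1 / 8) s * cap (1 / 8) b + cap (1 / 8) s * (1 - b) + (1 - s) * cap (1 / 8) b) +
  7 / 100 * (cap (1 / 4) s * cap (1 / 4) b + cap (1 / 4) s * (1 - b) + (1 - s) * cap (1 / 4) b)

theorem cap_of_le {c s : ℝ} (h : s ≤ c) : cap c s = 0 := max_eq_right (by linarith)

theorem cap_of_ge {c s : ℝ} (h : c ≤ s) : cap c s = s - c := max_eq_left (by linarith)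

/-- A case distinction by the position of a number in `[0, 1]` among the breakpoints of `share`. -/
theorem cap_cases {s : ℝ} (h0 : 0 ≤ s) (h1 : s ≤ 1) {p : Prop}
    (c1 : s ≤ 1 / 8 → cap 0 s = s → cap (1 / 8) s = 0 → cap (1 / 4) s = 0 → p)
    (c2 : 1 / 8 ≤ s → s ≤ 1 / 4 → cap 0 s = s → cap (1 / 8) s = s - 1 / 8 →
      cap (1 / 4) s = 0 → p)
    (c3 : 1 / 4 ≤ s → s ≤ 1 → cap 0 s = s → cap (1 / 8) s = s - 1 / 8 →
      cap (1 / 4) s = s - 1 / 4 → p) : p := by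
  have h : cap 0 s = s := by rw [cap_of_ge h0, sub_zero]
  rcases le_total s (1 / 8) with h8 | h8
  · exact c1 h8 h (cap_of_le h8) (cap_of_le (by linarith))
  rcases le_total s (1 / 4) with h4 | h4
  · exact c2 h8 h4 h (cap_of_ge h8) (cap_of_le h4)
  · exact c3 h4 h1 h (cap_of_ge h8) (cap_of_ge h4)

/-- The function `base s b + (1 - s) * E` is affine in `s` between the breakpoints of `share`, so it
is enough to bound it at these. -/
theorem le_base_add {s b E : ℝ} (hs0 : 0 ≤ s) (hs1 : s ≤ 1) (hb0 : 0 ≤ b)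
    (h0 : 5211 / 10000 ≤
      46 / 100 * b + 5 / 100 * cap (1 / 8) b + 7 / 100 * cap (1 / 4) b + E)
    (h1 : 5211 / 10000 ≤ 46 / 100 * (1 / 8 + 7 / 8 * b) +
      7 / 8 * (5 / 100 * cap (1 / 8) b + 7 / 100 * cap (1 / 4) b) + 7 / 8 * E)
    (h2 : 5211 / 10000 ≤ 46 / 100 * (1 / 4 + 3 / 4 * b) +
      5 / 100 * (7 / 8 * cap (1 / 8) b + (1 - b) / 8) + 3 / 4 * (7 / 100 * cap (1 / 4) b) +
      3 / 4 * E) :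
    5211 / 10000 ≤ base s b + (1 - s) * E := by
  have h3 : 5211 / 10000 ≤ 46 / 100 + 5 / 100 * (7 / 8 * (cap (1 / 8) b + (1 - b))) +
      7 / 100 * (3 / 4 * (cap (1 / 4) b + (1 - b))) := by
    have e1 : b - 1 / 8 ≤ cap (1 / 8) b := le_max_left _ _
    have e2 : b - 1 / 4 ≤ cap (1 / 4) b := le_max_left _ _
    linarith
  have hb : cap 0 b = b := by rw [cap_of_ge hb0, sub_zero]
  unfold base
  rw [hb]
  generalize cap (1 / 8) b = p at *
  generalize cap (1 / 4) b = q at *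
  refine cap_cases hs0 hs1 (fun s1 e1 e2 e3 => ?_) (fun s0 s1 e1 e2 e3 => ?_)
    (fun s0 s1 e1 e2 e3 => ?_) <;> rw [e1, e2, e3]
  · have k0 := mul_nonneg (sub_nonneg.2 s1) (sub_nonneg.2 h0)
    have k1 := mul_nonneg hs0 (sub_nonneg.2 h1)
    linarith
  · have k0 := mul_nonneg (sub_nonneg.2 s1) (sub_nonneg.2 h1)
    have k1 := mul_nonneg (sub_nonneg.2 s0) (sub_nonneg.2 h2)
    linarith
  · have k0 := mul_nonneg (sub_nonneg.2 hs1) (sub_nonneg.2 h2)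
    have k1 := mul_nonneg (sub_nonneg.2 s0) (sub_nonneg.2 h3)
    linarith

/-- The bound on the expected gain if `u` has no spare neighbor. -/
theorem bound_no_spare {s b : ℝ} (hs0 : 0 ≤ s) (hs1 : s ≤ 1) (hb0 : 0 ≤ b) (hb1 : b ≤ 1) :
    5211 / 10000 ≤ base s b + (1 - s) * (1 - b) := by
  refine le_base_add hs0 hs1 hb0 ?_ ?_ ?_ <;>
  refine cap_cases hb0 hb1 (fun b1 e1 e2 e3 => ?_) (fun b0 b1 e1 e2 e3 => ?_)
    (fun b0 b1 e1 e2 e3 => ?_) <;> rw [e2, e3] <;> linarith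

/-- The product of `share ρ` and `1 - max ρ b` is replaced by an upper bound `K` that is affine in
`b` between the breakpoints. -/
theorem bound_two_spare_aux {s b K : ℝ} (hs0 : 0 ≤ s) (hs1 : s ≤ 1) (hb0 : 0 ≤ b) (hb1 : b ≤ 1)
    (hK : K ≤ 46 / 100 * (1 - b) ∨ K ≤ 51 / 100 * (1 - b) ∧ K ≤ 51 / 100 * (7 / 8) ∨
      K ≤ 58 / 100 * (1 - b) ∧ K ≤ 58 / 100 * (3 / 4)) :
    5211 / 10000 ≤ base s b + (1 - s) * (42 / 100 * b + (1 - b) - K) := by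
  refine le_base_add hs0 hs1 hb0 ?_ ?_ ?_ <;>
  refine cap_cases hb0 hb1 (fun b1 e1 e2 e3 => ?_) (fun b0 b1 e1 e2 e3 => ?_)
    (fun b0 b1 e1 e2 e3 => ?_) <;> rw [e2, e3] <;>
  rcases hK with hK | ⟨hK, hK2⟩ | ⟨hK, hK2⟩ <;> linarith

/-- The bound on the expected gain if `u` has two spare neighbors, the best of rank `ρ`. -/
theorem bound_two_spare {s b ρ : ℝ} (hs0 : 0 ≤ s) (hs1 : s ≤ 1) (hb0 : 0 ≤ b) (hb1 : b ≤ 1)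
    (hρ1 : ρ ≤ 1) :
    5211 / 10000 ≤ base s b + (1 - s) *
      (42 / 100 * b + share ρ * (max ρ b - b) + (1 - share ρ) * (1 - b)) := by
  have h1 := share_nonneg ρ
  have h2 : max ρ b ≤ 1 := max_le hρ1 hb1
  have h3 : b ≤ max ρ b := le_max_right _ _
  have h4 : ρ ≤ max ρ b := le_max_left _ _
  have := bound_two_spare_aux (K := share ρ * (1 - max ρ b)) hs0 hs1 hb0 hb1 ?_
  · convert this using 2
    ring
  · by_cases h8 : 1 / 8 ≤ ρ
    · by_cases h4 : 1 / 4 ≤ ρ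
      · right; right
        have := share_le ρ
        constructor <;> exact mul_le_mul this (by linarith) (by linarith) (by norm_num)
      · right; left
        have : share ρ ≤ 51 / 100 := by
          unfold share
          have : step (1 / 4) ρ = 0 := if_neg h4
          linarith [step_le_one 0 ρ, step_le_one (1 / 8) ρ]
        constructor <;> exact mul_le_mul this (by linarith) (by linarith) (by norm_num)
    · left
      have : share ρ ≤ 46 / 100 := by
        unfold share
        have : step (1 / 8) ρ = 0 := if_neg h8
        have : step (1 / 4) ρ = 0 := if_neg (by linarith)
        linarith [step_le_one 0 ρ]
      exact mul_le_mul this (by linarith) (by linarith) (by norm_num)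

/-- The integral of `1 - max t b` over `t` from `z` to `1`. -/
noncomputable def tail (b z : ℝ) : ℝ :=
  if z ≤ b then (1 - z) * (1 - b) - (1 - b) ^ 2 / 2 else (1 - z) ^ 2 / 2

/-- The function `tail b` is convex: its tangents lie below it. -/
theorem tail_subgradient (b z w : ℝ) :
    tail b z - (1 - max z b) * (w - z) ≤ tail b w := by
  unfold tail
  rw [max_def]
  split_ifs with h1 h2 h2
  · linarith
  · nlinarith [sq_nonneg (w - b)]
  · nlinarith [sq_nonneg (z - b), mul_nonneg (sub_nonneg.2 (not_le.1 h1).le) (sub_nonneg.2 h2)]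
  · nlinarith [sq_nonneg (w - z)]

theorem tail_convex (b : ℝ) {x z w : ℝ} (hxz : x ≤ z) (hzw : z ≤ w) :
    (w - x) * tail b z ≤ (w - z) * tail b x + (z - x) * tail b w := by
  have h1 := mul_le_mul_of_nonneg_left (tail_subgradient b z x) (sub_nonneg.2 hzw)
  have h2 := mul_le_mul_of_nonneg_left (tail_subgradient b z w) (sub_nonneg.2 hxz)
  linarith

theorem tail_one {b : ℝ} (hb1 : b ≤ 1) : tail b 1 = 0 := by
  unfold tail
  split_ifs with h
  · rw [le_antisymm hb1 h]; norm_num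
  · norm_num

/-- The case `lo = 0` of `bound_one_spare`. Between the breakpoints the bounds are convex quadratic
polynomials in `b`, whence the squares. -/
theorem bound_one_spare_zero {s b : ℝ} (hs0 : 0 ≤ s) (hs1 : s ≤ 1) (hb0 : 0 ≤ b) (hb1 : b ≤ 1) :
    5211 / 10000 ≤ base s b + (1 - s) * ((1 - b) - (46 / 100 * tail b 0 +
      5 / 100 * tail b (1 / 8) + 7 / 100 * tail b (1 / 4))) := by
  have h0 : tail b 0 = (1 - 0) * (1 - b) - (1 - b) ^ 2 / 2 := if_pos hb0
  rw [h0]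
  unfold tail
  refine le_base_add hs0 hs1 hb0 ?_ ?_ ?_ <;>
  refine cap_cases hb0 hb1 (fun b1 e1 e2 e3 => ?_) (fun b0 b1 e1 e2 e3 => ?_)
    (fun b0 b1 e1 e2 e3 => ?_) <;> rw [e2, e3] <;> split_ifs <;>
    nlinarith [sq_nonneg (b - 3 / 4), sq_nonneg (b - 1 / 4), sq_nonneg (b - 1 / 8)]

/-- The case `lo = 1 / 8` of `bound_one_spare`. -/
theorem bound_one_spare_eighth {s b : ℝ} (hs0 : 0 ≤ s) (hs1 : s ≤ 1) (hb0 : 0 ≤ b) (hb1 : b ≤ 1) :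
    5211 / 10000 ≤ base s b + (1 - s) * ((1 - b) - 8 / 7 * (51 / 100 * tail b (1 / 8) +
      7 / 100 * tail b (1 / 4))) := by
  unfold tail
  refine le_base_add hs0 hs1 hb0 ?_ ?_ ?_ <;>
  refine cap_cases hb0 hb1 (fun b1 e1 e2 e3 => ?_) (fun b0 b1 e1 e2 e3 => ?_)
    (fun b0 b1 e1 e2 e3 => ?_) <;> rw [e2, e3] <;> split_ifs <;>
    nlinarith [sq_nonneg (b - 3 / 4), sq_nonneg (b - 1 / 4), sq_nonneg (b - 1 / 8)]

/-- The case `lo = 1 / 4` of `bound_one_spare`. -/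
theorem bound_one_spare_quarter {s b : ℝ} (hs0 : 0 ≤ s) (hs1 : s ≤ 1) (hb0 : 0 ≤ b) (hb1 : b ≤ 1) :
    5211 / 10000 ≤ base s b + (1 - s) * ((1 - b) - 4 / 3 * (58 / 100 * tail b (1 / 4))) := by
  unfold tail
  refine le_base_add hs0 hs1 hb0 ?_ ?_ ?_ <;>
  refine cap_cases hb0 hb1 (fun b1 e1 e2 e3 => ?_) (fun b0 b1 e1 e2 e3 => ?_)
    (fun b0 b1 e1 e2 e3 => ?_) <;> rw [e2, e3] <;> split_ifs <;>
    nlinarith [sq_nonneg (b - 3 / 4), sq_nonneg (b - 1 / 4), sq_nonneg (b - 1 / 8)]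

/-- The bound on the expected gain if `u` has one spare neighbor whose rank is uniform on
`[lo, 1)`, multiplied by `1 - lo`. The difference of the two sides is concave in `lo` between the
breakpoints of `share`, so the cases in which `lo` is a breakpoint suffice. -/
theorem bound_one_spare {s b lo : ℝ} (hs0 : 0 ≤ s) (hs1 : s ≤ 1) (hb0 : 0 ≤ b) (hb1 : b ≤ 1)
    (hl0 : 0 ≤ lo) (hl1 : lo ≤ 1) :
    (1 - s) * (46 / 100 * tail b (max lo 0) + 5 / 100 * tail b (max lo (1 / 8)) +
        7 / 100 * tail b (max lo (1 / 4))) ≤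
      (1 - lo) * (base s b + (1 - s) * (1 - b) - 5211 / 10000) := by
  have k0 := bound_one_spare_zero hs0 hs1 hb0 hb1
  have k1 := bound_one_spare_eighth hs0 hs1 hb0 hb1
  have k2 := bound_one_spare_quarter hs0 hs1 hb0 hb1
  have hs : 0 ≤ 1 - s := by linarith
  rw [max_eq_left hl0]
  rcases le_total lo (1 / 8) with h8 | h8
  · rw [max_eq_right h8, max_eq_right (by linarith)]
    have hc := mul_le_mul_of_nonneg_left (tail_convex b hl0 h8) hs
    have m0 := mul_le_mul_of_nonneg_left k0 (sub_nonneg.2 h8)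
    have m1 := mul_le_mul_of_nonneg_left k1 hl0
    linarith
  rcases le_total lo (1 / 4) with h4 | h4
  · rw [max_eq_left h8, max_eq_right h4]
    have hc := mul_le_mul_of_nonneg_left (tail_convex b h8 h4) hs
    have m0 := mul_le_mul_of_nonneg_left k1 (sub_nonneg.2 h4)
    have m1 := mul_le_mul_of_nonneg_left k2 (sub_nonneg.2 h8)
    linarith
  · rw [max_eq_left h8, max_eq_left h4]
    have hc := mul_le_mul_of_nonneg_left (tail_convex b h4 hl1) hs
    rw [tail_one hb1] at hc
    have m0 := mul_le_mul_of_nonneg_left k2 (sub_nonneg.2 hl1)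
    linarith

/-! ### Resampling single ranks -/

section Resampling

/-- The uniform distribution on `[0, 1)`. -/
noncomputable abbrev unif : Measure ℝ := volume.restrict (Set.Ico (0 : ℝ) 1)

instance : IsProbabilityMeasure unif := ⟨by simp [unif]⟩

variable {V : Type*}

open Classical in
theorem measurable_update_prod (i : V) :
    Measurable fun p : (V → ℝ) × ℝ => Function.update p.1 i p.2 := by
  rw [measurable_pi_iff]
  intro j
  by_cases hj : j = i
  · subst hj
    simpa using measurable_snd
  · simp only [Function.update_of_ne hj]
    fun_prop

/-- Bounded measurable functions of the ranks. -/
structure BddMeasurable {α : Type*} [MeasurableSpace α] (f : α → ℝ) : Prop where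
  measurable : Measurable f
  bounded : ∃ C, ∀ y, |f y| ≤ C

theorem BddMeasurable.integrable {α : Type*} [MeasurableSpace α] {f : α → ℝ}
    (hf : BddMeasurable f) (μ : Measure α) [IsFiniteMeasure μ] : Integrable f μ := by
  obtain ⟨C, hC⟩ := hf.bounded
  exact Integrable.of_bound hf.measurable.aestronglyMeasurable C (ae_of_all _ hC)

open Classical in
/-- The conditional expectation of `f` given all ranks but the one of `i`. -/
noncomputable def resample (i : V) (f : (V → ℝ) → ℝ) (y : V → ℝ) : ℝ :=
  ∫ t, f (Function.update y i t) ∂unif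

open Classical in
theorem BddMeasurable.update {f : (V → ℝ) → ℝ} (hf : BddMeasurable f) (i : V) (y : V → ℝ) :
    BddMeasurable fun t => f (Function.update y i t) :=
  ⟨hf.measurable.comp ((measurable_update_prod i).comp measurable_prodMk_left),
    hf.bounded.imp fun _ hC _ => hC _⟩

open Classical in
theorem BddMeasurable.resample {f : (V → ℝ) → ℝ} (hf : BddMeasurable f) (i : V) :
    BddMeasurable (resample i f) := by
  refine ⟨?_, hf.bounded.imp fun C hC y => ?_⟩
  · have : Measurable fun p : (V → ℝ) × ℝ => f (Function.update p.1 i p.2) :=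
      hf.measurable.comp (measurable_update_prod i)
    exact (this.stronglyMeasurable.integral_prod_right' (ν := unif)).measurable
  · have := norm_integral_le_of_norm_le_const (μ := unif)
      (f := fun t => f (Function.update y i t)) (ae_of_all _ fun t => hC (Function.update y i t))
    simpa [FullyOnlineMatching.resample] using this

variable [Fintype V]

instance : IsProbabilityMeasure (rankMeasure V) := by
  unfold rankMeasure; infer_instance

theorem ae_unif : ∀ᵐ t ∂unif, t ∈ Set.Ico (0 : ℝ) 1 := ae_restrict_mem measurableSet_Ico

theorem ae_rankMeasure : ∀ᵐ y ∂rankMeasure V, ∀ v, y v ∈ Set.Ico (0 : ℝ) 1 := by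
  rw [ae_all_iff]
  intro v
  exact (measurePreserving_eval (fun _ : V => unif) v).quasiMeasurePreserving.ae ae_unif

open Classical in
/-- Replacing one rank by an independent fresh one does not change the joint law. -/
theorem measurePreserving_update (i : V) :
    MeasurePreserving (fun p : (V → ℝ) × ℝ => Function.update p.1 i p.2)
      ((rankMeasure V).prod unif) (rankMeasure V) := by
  refine ⟨measurable_update_prod i, (Measure.pi_eq fun s hs => ?_).symm⟩
  rw [Measure.map_apply (measurable_update_prod i) (MeasurableSet.univ_pi hs)]
  have : (fun p : (V → ℝ) × ℝ => Function.update p.1 i p.2) ⁻¹' Set.univ.pi s =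
      Set.univ.pi (Function.update s i Set.univ) ×ˢ s i := by
    ext p
    simp only [Set.mem_preimage, Set.mem_pi, Set.mem_univ, true_implies, Set.mem_prod]
    constructor
    · intro hp
      refine ⟨fun j => ?_, by simpa using hp i⟩
      by_cases hj : j = i
      · subst hj; simp
      · simpa [Function.update_of_ne hj] using hp j
    · rintro ⟨h1, h2⟩ j
      by_cases hj : j = i
      · subst hj; simpa using h2
      · simpa [Function.update_of_ne hj] using h1 j
  rw [this, Measure.prod_prod, rankMeasure, Measure.pi_pi, ← Finset.prod_erase_mul _ _
    (Finset.mem_univ i), ← Finset.prod_erase_mul _ _ (Finset.mem_univ i)]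
  have h1 : ∏ x ∈ Finset.univ.erase i, unif (Function.update s i Set.univ x) =
      ∏ x ∈ Finset.univ.erase i, unif (s x) :=
    Finset.prod_congr rfl fun x hx => by rw [Function.update_of_ne (Finset.ne_of_mem_erase hx)]
  rw [h1, Function.update_self, measure_univ, mul_one]

open Classical in
theorem integral_resample {f : (V → ℝ) → ℝ} (hf : BddMeasurable f) (i : V) :
    ∫ y, resample i f y ∂rankMeasure V = ∫ y, f y ∂rankMeasure V := by
  have hp := measurePreserving_update i
  have h1 : ∫ p, f (Function.update p.1 i p.2) ∂((rankMeasure V).prod unif) =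
      ∫ y, f y ∂rankMeasure V := by
    have := integral_map hp.aemeasurable
      (hf.measurable.aestronglyMeasurable (μ := Measure.map _ ((rankMeasure V).prod unif)))
    rw [hp.map_eq] at this
    exact this.symm
  rw [← h1, integral_prod]
  · rfl
  · exact hp.integrable_comp_of_integrable (hf.integrable _)

/-- A property of the ranks that depends only on their order is measurable. -/
theorem measurableSet_of_order {p : (V → ℝ) → Prop}
    (hp : ∀ y y', (∀ a b, y a ≤ y b ↔ y' a ≤ y' b) → p y → p y') : MeasurableSet {y | p y} := by
  have hm : Measurable fun (y : V → ℝ) (q : V × V) => (y q.1 ≤ y q.2 : Prop) := by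
    rw [measurable_pi_iff]
    intro q
    exact measurableSet_setOfPred.1
      (measurableSet_le (measurable_pi_apply _) (measurable_pi_apply _))
  have : {y | p y} = (fun (y : V → ℝ) (q : V × V) => (y q.1 ≤ y q.2 : Prop)) ⁻¹'
      ((fun (y : V → ℝ) (q : V × V) => (y q.1 ≤ y q.2 : Prop)) '' {y | p y}) := by
    refine Set.Subset.antisymm (Set.subset_preimage_image _ _) ?_
    rintro y' ⟨y, hy, hyy⟩
    exact hp y y' (fun a b => by simpa using congrFun hyy (a, b)) hy
  rw [this]
  exact hm (Set.toFinite _).measurableSet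

end Resampling

/-! ### Integrals over a single rank -/

section Integrals

theorem integral_unif_indicator {S : Set ℝ} (hS : MeasurableSet S) :
    ∫ t, S.indicator 1 t ∂unif = volume.real (S ∩ Set.Ico 0 1) := by
  rw [integral_indicator_one hS, measureReal_restrict_apply hS]

theorem integrable_unif_indicator {S : Set ℝ} (hS : MeasurableSet S) :
    Integrable (S.indicator (1 : ℝ → ℝ)) unif :=
  (integrable_const (1 : ℝ)).indicator hS

theorem integral_between {b r : ℝ} (h0 : 0 ≤ b) (h1 : r ≤ 1) :
    ∫ t, (Set.Ioo b r).indicator 1 t ∂unif = max r b - b := by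
  have : Set.Ioo b r ∩ Set.Ico 0 1 = Set.Ioo b r := by
    rw [Set.inter_eq_left]
    rintro t ⟨h2, h3⟩
    exact ⟨by linarith, by linarith⟩
  rw [integral_unif_indicator measurableSet_Ioo, this, Real.volume_real_Ioo,
    ← max_sub_sub_right, sub_self]

end Integrals

theorem integral_comb {α : Type*} [MeasurableSpace α] {μ : Measure α} {f₀ f₁ f₂ f₃ f₄ : α → ℝ}
    (k₀ k₁ k₂ k₃ k₄ : ℝ) (h₀ : Integrable f₀ μ) (h₁ : Integrable f₁ μ) (h₂ : Integrable f₂ μ)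
    (h₃ : Integrable f₃ μ) (h₄ : Integrable f₄ μ) :
    Integrable (fun t => k₀ * f₀ t + k₁ * f₁ t + k₂ * f₂ t + k₃ * f₃ t + k₄ * f₄ t) μ ∧
    ∫ t, (k₀ * f₀ t + k₁ * f₁ t + k₂ * f₂ t + k₃ * f₃ t + k₄ * f₄ t) ∂μ =
      k₀ * ∫ t, f₀ t ∂μ + k₁ * ∫ t, f₁ t ∂μ + k₂ * ∫ t, f₂ t ∂μ + k₃ * ∫ t, f₃ t ∂μ +
        k₄ * ∫ t, f₄ t ∂μ := by
  have i₀ := h₀.const_mul k₀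
  have i₁ := h₁.const_mul k₁
  have i₂ := h₂.const_mul k₂
  have i₃ := h₃.const_mul k₃
  have i₄ := h₄.const_mul k₄
  refine ⟨(((i₀.add i₁).add i₂).add i₃).add i₄, ?_⟩
  have j₁ : Integrable (fun t => k₀ * f₀ t + k₁ * f₁ t) μ := i₀.add i₁
  have j₂ : Integrable (fun t => k₀ * f₀ t + k₁ * f₁ t + k₂ * f₂ t) μ := j₁.add i₂
  have j₃ : Integrable (fun t => k₀ * f₀ t + k₁ * f₁ t + k₂ * f₂ t + k₃ * f₃ t) μ := j₂.add i₃
  rw [integral_add j₃ i₄, integral_add j₂ i₃, integral_add j₁ i₂, integral_add i₀ i₁]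
  simp only [integral_const_mul]

/-! ### The gain of an edge with given thresholds -/

/-- A lower bound on the gain of the endpoints of an edge whose ranks are `p` and `q`, in terms of
their thresholds `s` and `b`, of the rank `ρ` of the best spare neighbor, and of the guaranteed
gain `k` of `u` if only `v` is below its threshold. On the null set where a rank equals its
threshold the bound is `0`. -/
noncomputable def profile (s b ρ k p q : ℝ) : ℝ :=
  if p < s then
    if q < b then min (share p) (share q) else if b < q then share p else 0
  else if s < p then
    if q < b then share q + k else if b < q then 1 - share ρ + (if q < ρ then share ρ else 0) else 0
  else 0

/-- The products of steps arise because all steps of `share` are monotone. -/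
theorem min_share (p q : ℝ) : min (share p) (share q) =
    46 / 100 * (step 0 p * step 0 q) + 5 / 100 * (step (1 / 8) p * step (1 / 8) q) +
      7 / 100 * (step (1 / 4) p * step (1 / 4) q) := by
  have key : ∀ c p q, p ≤ q → step c p * step c q = step c p := by
    intro c p q hpq
    unfold step
    split_ifs with h1 h2
    · norm_num
    · exact absurd (h1.trans hpq) h2
    · norm_num
    · norm_num
  rcases le_total p q with h | h
  · rw [min_eq_left (share_mono h), key _ _ _ h, key _ _ _ h, key _ _ _ h, share]
  · rw [min_eq_right (share_mono h), mul_comm (step 0 p), mul_comm (step (1 / 8) p),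
      mul_comm (step (1 / 4) p), key _ _ _ h, key _ _ _ h, key _ _ _ h, share]

/-- The indicator function of the ranks between `c` and the threshold `s`. -/
noncomputable def below (c s t : ℝ) : ℝ := (Set.Ico c s).indicator 1 t

/-- The indicator function of the ranks above the threshold `s`. -/
noncomputable def above (s t : ℝ) : ℝ := (Set.Ioi s).indicator 1 t

theorem below_of_lt {c s t : ℝ} (h : t < s) : below c s t = step c t := by
  simp [below, step, Set.indicator_apply, h]

theorem below_of_le {c s t : ℝ} (h : s ≤ t) : below c s t = 0 := by
  simp [below, h.not_gt]

theorem above_of_lt {s t : ℝ} (h : s < t) : above s t = 1 := by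
  simp [above, h]

theorem above_of_le {s t : ℝ} (h : t ≤ s) : above s t = 0 := by
  simp [above, h.not_gt]

/-- The profile is a sum of products of a function of `p` and a function of `q`. -/
theorem profile_eq {s b ρ k p q : ℝ} (hq : 0 ≤ q) : profile s b ρ k p q =
    (46 / 100 * below 0 s p + (46 / 100 + k) * above s p) * below 0 b q +
      5 / 100 * (below (1 / 8) s p + above s p) * below (1 / 8) b q +
      7 / 100 * (below (1 / 4) s p + above s p) * below (1 / 4) b q +
      (46 / 100 * below 0 s p + 5 / 100 * below (1 / 8) s p + 7 / 100 * below (1 / 4) s p +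
        (1 - share ρ) * above s p) * above b q +
      share ρ * above s p * (Set.Ioo b ρ).indicator 1 q := by
  unfold profile
  have hq0 : step 0 q = 1 := if_pos hq
  rcases lt_trichotomy p s with hp | rfl | hp
  · simp only [below_of_lt hp, above_of_le hp.le, if_pos hp]
    rcases lt_trichotomy q b with h | rfl | h
    · simp only [below_of_lt h, above_of_le h.le, if_pos h, min_share]
      ring
    · simp [below_of_le le_rfl, above_of_le le_rfl]
    · simp only [below_of_le h.le, above_of_lt h, if_neg h.not_gt, if_pos h, share]
      ring
  · simp [below_of_le le_rfl, above_of_le le_rfl]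
  · simp only [below_of_le hp.le, above_of_lt hp, if_pos hp, if_neg hp.not_gt]
    rcases lt_trichotomy q b with h | rfl | h
    · have : q ∉ Set.Ioo b ρ := fun hh => hh.1.not_gt h
      simp only [below_of_lt h, above_of_le h.le, if_pos h, share, hq0,
        Set.indicator_of_notMem this]
      ring
    · simp [below_of_le le_rfl, above_of_le le_rfl]
    · simp only [below_of_le h.le, above_of_lt h, if_neg h.not_gt, Set.indicator_apply,
        Set.mem_Ioo, h, true_and, Pi.one_apply]
      split_ifs <;> ring

theorem integral_below {c s : ℝ} (hc : 0 ≤ c) (hs : s ≤ 1) :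
    ∫ t, below c s t ∂unif = cap c s := by
  unfold below
  rw [integral_unif_indicator measurableSet_Ico, Set.Ico_inter_Ico, Real.volume_real_Ico,
    sup_eq_left.2 hc, inf_eq_left.2 hs, cap]

theorem integral_above {s : ℝ} (h0 : 0 ≤ s) (h1 : s ≤ 1) :
    ∫ t, above s t ∂unif = 1 - s := by
  have : Set.Ioi s ∩ Set.Ico 0 1 = Set.Ioo s 1 := by
    ext t; simp only [Set.mem_inter_iff, Set.mem_Ioi, Set.mem_Ico, Set.mem_Ioo]
    constructor
    · tauto
    · rintro ⟨h2, h3⟩; exact ⟨h2, by linarith, h3⟩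
  unfold above
  rw [integral_unif_indicator measurableSet_Ioi, this, Real.volume_real_Ioo,
    max_eq_left (by linarith)]

theorem integrable_below (c s : ℝ) : Integrable (below c s) unif :=
  integrable_unif_indicator measurableSet_Ico

theorem integrable_above (s : ℝ) : Integrable (above s) unif :=
  integrable_unif_indicator measurableSet_Ioi

/-- The expected gain of the endpoints of an edge when only the ranks of these two are random. -/
theorem le_integral_of_profile_le {s b ρ k : ℝ} (hs0 : 0 ≤ s) (hs1 : s ≤ 1) (hb0 : 0 ≤ b)
    (hb1 : b ≤ 1) (hρ : ρ ≤ 1) {T : ℝ → ℝ → ℝ} (hT : ∀ p, Integrable (T p) unif)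
    (hT' : Integrable (fun p => ∫ q, T p q ∂unif) unif)
    (h : ∀ p ∈ Set.Ico (0 : ℝ) 1, ∀ q ∈ Set.Ico (0 : ℝ) 1, profile s b ρ k p q ≤ T p q) :
    base s b + (1 - s) * (k * b + share ρ * (max ρ b - b) + (1 - share ρ) * (1 - b)) ≤
      ∫ p, ∫ q, T p q ∂unif ∂unif := by
  have hb : cap 0 b = b := by rw [cap_of_ge hb0, sub_zero]
  have hin : ∀ p ∈ Set.Ico (0 : ℝ) 1,
      (46 / 100 * (cap 0 b + (1 - b))) * below 0 s p +
        (5 / 100 * (cap (1 / 8) b + (1 - b))) * below (1 / 8) s p +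
        (7 / 100 * (cap (1 / 4) b + (1 - b))) * below (1 / 4) s p +
        ((46 / 100 + k) * cap 0 b + 5 / 100 * cap (1 / 8) b + 7 / 100 * cap (1 / 4) b +
          (1 - share ρ) * (1 - b) + share ρ * (max ρ b - b)) * above s p + 0 * above s p ≤
      ∫ q, T p q ∂unif := by
    intro p hp
    obtain ⟨i1, i2⟩ := integral_comb
      (46 / 100 * below 0 s p + (46 / 100 + k) * above s p)
      (5 / 100 * (below (1 / 8) s p + above s p))
      (7 / 100 * (below (1 / 4) s p + above s p))
      (46 / 100 * below 0 s p + 5 / 100 * below (1 / 8) s p + 7 / 100 * below (1 / 4) s p +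
        (1 - share ρ) * above s p)
      (share ρ * above s p)
      (integrable_below 0 b) (integrable_below (1 / 8) b) (integrable_below (1 / 4) b)
      (integrable_above b)
      (integrable_unif_indicator (measurableSet_Ioo (a := b) (b := ρ)))
    refine le_trans (le_of_eq ?_) (integral_mono_ae i1 (hT p) (ae_unif.mono fun q hq => ?_))
    · rw [i2, integral_below le_rfl hb1, integral_below (by norm_num) hb1,
        integral_below (by norm_num) hb1, integral_above hb0 hb1, integral_between hb0 hρ]
      ring
    · refine le_trans (le_of_eq ?_) (h p hp q hq)
      rw [profile_eq hq.1]
  obtain ⟨i1, i2⟩ := integral_comb (46 / 100 * (cap 0 b + (1 - b)))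
    (5 / 100 * (cap (1 / 8) b + (1 - b))) (7 / 100 * (cap (1 / 4) b + (1 - b)))
    ((46 / 100 + k) * cap 0 b + 5 / 100 * cap (1 / 8) b + 7 / 100 * cap (1 / 4) b +
      (1 - share ρ) * (1 - b) + share ρ * (max ρ b - b)) 0
    (integrable_below 0 s) (integrable_below (1 / 8) s) (integrable_below (1 / 4) s)
    (integrable_above s) (integrable_above s)
  refine le_trans (le_of_eq ?_) (integral_mono_ae i1 hT' (ae_unif.mono hin))
  rw [i2, integral_below le_rfl hs1, integral_below (by norm_num) hs1,
    integral_below (by norm_num) hs1, integral_above hs0 hs1]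
  unfold base
  rw [hb]
  ring

theorem integral_tail {b z : ℝ} (hb1 : b ≤ 1) (hz0 : 0 ≤ z) (hz1 : z ≤ 1) :
    ∫ t, (Set.Ico z 1).indicator (fun t => 1 - max t b) t ∂unif = tail b z := by
  have hcont : Continuous fun t : ℝ => 1 - max t b := by fun_prop
  have hlin : ∀ x w : ℝ, ∫ t in x..w, (1 - t) = (1 - x) ^ 2 / 2 - (1 - w) ^ 2 / 2 := by
    intro x w
    rw [intervalIntegral.integral_sub (by simp) (by simp)]
    simp
    ring
  have hge : ∀ x, b ≤ x → x ≤ 1 → ∫ t in x..1, (1 - max t b) = (1 - x) ^ 2 / 2 := by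
    intro x hx hx1
    rw [intervalIntegral.integral_congr (g := fun t => 1 - t), hlin]
    · norm_num
    · intro t ht
      rw [Set.uIcc_of_le hx1] at ht
      simp only [max_eq_left (hx.trans ht.1)]
  rw [integral_indicator measurableSet_Ico, Measure.restrict_restrict measurableSet_Ico,
    Set.Ico_inter_Ico, sup_eq_left.2 hz0, inf_idem, integral_Ico_eq_integral_Ioc,
    ← intervalIntegral.integral_of_le hz1]
  unfold tail
  split_ifs with h
  · rw [← intervalIntegral.integral_add_adjacent_intervals (b := b)
      (hcont.intervalIntegrable _ _) (hcont.intervalIntegrable _ _), hge b le_rfl hb1,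
      intervalIntegral.integral_congr (g := fun _ => 1 - b)]
    · simp
      ring
    · intro t ht
      rw [Set.uIcc_of_le h] at ht
      simp only [max_eq_right ht.2]
  · exact hge z (not_le.1 h).le hz1

theorem integrable_tail (b z : ℝ) :
    Integrable ((Set.Ico z 1).indicator (fun t => 1 - max t b)) unif := by
  have hcont : Continuous fun t : ℝ => 1 - max t b := by fun_prop
  exact ((hcont.integrableOn_Icc (a := 0) (b := 1)).mono_set Set.Ico_subset_Icc_self).indicator
    measurableSet_Ico

/-- The expected gain when `u` has exactly one spare neighbor: the set of those ranks of this
neighbor for which it is the only spare one is up-closed, and the thresholds do not depend on its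
rank there. -/
theorem integral_nonneg_of_one_spare {s b : ℝ} (hs0 : 0 ≤ s) (hs1 : s ≤ 1) (hb0 : 0 ≤ b)
    (hb1 : b ≤ 1) {U : Set ℝ} (hU : ∀ t ∈ U, ∀ t', t ≤ t' → t' < 1 → t' ∈ U)
    (hUn : U.Nonempty) (hU0 : ∀ t ∈ U, 0 ≤ t ∧ t < 1)
    {Φ : ℝ → ℝ} (hΦ : Integrable Φ unif)
    (h1 : ∀ t ∈ U, base s b + (1 - s) * (share t * (max t b - b) + (1 - share t) * (1 - b)) -
      5211 / 10000 ≤ Φ t)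
    (h2 : ∀ t ∈ Set.Ico (0 : ℝ) 1, t ∉ U → 0 ≤ Φ t) : 0 ≤ ∫ t, Φ t ∂unif := by
  -- Up to its left endpoint `lo`, the set `U` is the interval `[lo, 1)`.
  set lo := sInf U with hlo
  have hbdd : BddBelow U := ⟨0, fun t ht => (hU0 t ht).1⟩
  have hl0 : 0 ≤ lo := le_csInf hUn fun t ht => (hU0 t ht).1
  have hl1 : lo ≤ 1 := by
    obtain ⟨t, ht⟩ := hUn
    exact (csInf_le hbdd ht).trans (hU0 t ht).2.le
  have hmem : ∀ t, lo < t → t < 1 → t ∈ U := by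
    intro t ht ht1
    obtain ⟨t', ht', hlt⟩ := exists_lt_of_csInf_lt hUn ht
    exact hU t' ht' t hlt.le ht1
  have hnot : ∀ t, t < lo → t ∉ U := fun t ht hh => ht.not_ge (csInf_le hbdd hh)
  set K := base s b + (1 - s) * (1 - b) - 5211 / 10000 with hK
  obtain ⟨i1, i2⟩ := integral_comb K (-((1 - s) * (46 / 100))) (-((1 - s) * (5 / 100)))
    (-((1 - s) * (7 / 100))) 0 (integrable_above lo) (integrable_tail b (max lo 0))
    (integrable_tail b (max lo (1 / 8))) (integrable_tail b (max lo (1 / 4)))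
    (integrable_above lo)
  have hint := bound_one_spare hs0 hs1 hb0 hb1 hl0 hl1
  have hne : ∀ᵐ t ∂unif, t ≠ lo := by
    refine ae_restrict_of_ae ?_
    rw [ae_iff]
    simp
  have hmono := integral_mono_ae i1 hΦ (by
    filter_upwards [ae_unif, hne] with t ht htlo
    rcases lt_or_gt_of_ne htlo with hlt | hgt
    · have hz : ∀ c, (Set.Ico (max lo c) 1).indicator (fun t => 1 - max t b) t = 0 := fun c =>
        Set.indicator_of_notMem (fun hh => hlt.not_ge ((le_max_left _ _).trans hh.1)) _
      rw [hz, hz, hz, above_of_le hlt.le]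
      simpa using h2 t ht (hnot t hlt)
    · refine le_trans (le_of_eq ?_) (h1 t (hmem t hgt ht.2))
      have hz : ∀ c, (Set.Ico (max lo c) 1).indicator (fun t => 1 - max t b) t =
          step c t * (1 - max t b) := by
        intro c
        by_cases hc : c ≤ t
        · rw [Set.indicator_of_mem (Set.mem_Ico.2 ⟨max_le hgt.le hc, ht.2⟩), step, if_pos hc,
            one_mul]
        · rw [Set.indicator_of_notMem (fun hh => hc ((le_max_right _ _).trans hh.1)), step,
            if_neg hc, zero_mul]
      rw [hz, hz, hz, above_of_lt hgt, hK, share]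
      ring)
  refine le_trans ?_ hmono
  rw [i2, integral_above hl0 hl1, integral_tail hb1 (le_max_right _ _) (max_le hl1 zero_le_one),
    integral_tail hb1 (hl0.trans (le_max_left _ _)) (max_le hl1 (by norm_num)),
    integral_tail hb1 (hl0.trans (le_max_left _ _)) (max_le hl1 (by norm_num))]
  rw [← hK] at hint
  linarith

/-! ### The expected gain of an edge -/

section Edge

variable {V : Type*} {G : SimpleGraph V} {h H : List (Event V)} {u v x : V} {y y' : V → ℝ}

theorem spare_congr (hy : ∀ w ∈ ({u, v}ᶜ : Set V), y w = y' w) :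
    spare G u v h y = spare G u v h y' := by
  unfold spare
  rw [free_congr hy]

theorem spare_congr_order (hy : ∀ a b, y a ≤ y b ↔ y' a ≤ y' b) :
    spare G u v h y = spare G u v h y' := by
  unfold spare
  rw [(run_congr_order fun a _ b _ => hy a b).1]

open Classical in
/-- Raising the rank of the only spare neighbor changes neither the spare neighbors nor the
thresholds. -/
theorem spare_update_raise {t t' : ℝ} (htt : t ≤ t')
    (ht : spare G u v h (Function.update y x t) = {x}) :
    spare G u v h (Function.update y x t') = {x} ∧
      ∀ z, thr G (Function.update y x t') {u, v}ᶜ z h =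
        thr G (Function.update y x t) {u, v}ᶜ z h := by
  have hx : x ∈ spare G u v h (Function.update y x t) := by rw [ht]; rfl
  have hne : ∀ a, a ≠ x → Function.update y x t' a = Function.update y x t a := fun a ha => by
    rw [Function.update_of_ne ha, Function.update_of_ne ha]
  have hle : Function.update y x t x ≤ Function.update y x t' x := by simpa using htt
  refine ⟨?_, fun z => thr_raise hx.2.2 hne hle⟩
  rw [← ht]
  unfold spare
  rw [free_raise hx.2.2 hne hle]

variable [Fintype V]

theorem Critical.profile_le (hC : Critical G H u v h) (hy : ∀ w, 0 ≤ y w ∧ y w ≤ 1) {ρ k : ℝ}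
    (hρ : ∀ w ∈ spare G u v h y, ρ ≤ y w)
    (hρ' : ρ = 1 ∨ ∃ w ∈ spare G u v h y, y w = ρ)
    (hk : k = 0 ∨ k = 42 / 100 ∧ (spare G u v h y).Nontrivial) :
    profile (thr G y {u, v}ᶜ u h) (thr G y {u, v}ᶜ v h) ρ k (y u) (y v) ≤
      gain G H u y + gain G H v y := by
  have h0 : 0 ≤ gain G H u y + gain G H v y := add_nonneg gain_nonneg gain_nonneg
  unfold profile
  split_ifs with h1 h2 h3 h4 h5 h6 h7
  · exact hC.gain_both hy h1
  · exact hC.gain_first hy h1 h3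
  · exact h0
  · have := hC.gain_second hy h4 h5
    rcases hk with rfl | ⟨rfl, hk⟩
    · simpa using this.1
    · exact this.2 hk
  · have := hC.gain_clean hy hρ hρ' h4 h6
    rwa [if_pos h7] at this
  · have := hC.gain_clean hy hρ hρ' h4 h6
    rwa [if_neg h7] at this
  · exact h0
  · exact h0

theorem bddMeasurable_gain (G : SimpleGraph V) (H : List (Event V)) (w : V) :
    BddMeasurable (gain G H w) := by
  classical
  have hm : ∀ a c : V, MeasurableSet {y : V → ℝ | (a, c) ∈ pairs G y Set.univ H} := fun a c =>
    measurableSet_of_order fun y y' hy hp => by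
      rwa [← (run_congr_order (h := H) fun a _ b _ => hy a b).2]
  have hs : ∀ c : V, Measurable fun y : V → ℝ => share (y c) := fun c =>
    share_mono.measurable.comp (measurable_pi_apply c)
  refine ⟨?_, 2 * Fintype.card V, fun y => ?_⟩
  · unfold gain
    refine Measurable.add (Finset.measurable_sum _ fun c _ => ?_)
      (Finset.measurable_sum _ fun a _ => ?_)
    · exact Measurable.ite (hm w c) (measurable_const.sub (hs c)) measurable_const
    · exact Measurable.ite (hm a w) (hs w) measurable_const
  · rw [abs_of_nonneg gain_nonneg]
    exact gain_le

open Classical in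
/-- The excess of the gain of `u` and `v` over the competitive ratio, on the event that the set of
spare neighbors satisfies `p`. -/
noncomputable def excess (G : SimpleGraph V) (H : List (Event V)) (u v : V) (h : List (Event V))
    (p : Set V → Prop) (y : V → ℝ) : ℝ :=
  if p (spare G u v h y) then gain G H u y + gain G H v y - 5211 / 10000 else 0

theorem bddMeasurable_excess (G : SimpleGraph V) (H : List (Event V)) (u v : V)
    (h : List (Event V)) (p : Set V → Prop) : BddMeasurable (excess G H u v h p) := by
  have hu := bddMeasurable_gain G H u
  have hv := bddMeasurable_gain G H v
  obtain ⟨C, hC⟩ := hu.bounded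
  obtain ⟨D, hD⟩ := hv.bounded
  refine ⟨?_, C + D + 5211 / 10000, fun y => ?_⟩
  · unfold excess
    refine Measurable.ite (measurableSet_of_order fun y y' hy hp => ?_)
      ((hu.measurable.add hv.measurable).sub measurable_const) measurable_const
    rwa [← spare_congr_order hy]
  · have h1 := hC y
    have h2 := hD y
    have h3 := abs_nonneg (gain G H u y)
    have h4 := abs_nonneg (gain G H v y)
    unfold excess
    split_ifs
    · rw [abs_le] at h1 h2 ⊢
      constructor <;> linarith
    · rw [abs_zero]; linarith

open Classical in
/-- The spare neighbors, and hence the event, do not depend on the ranks of `u` and `v`. -/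
theorem resample_excess_of_not {p : Set V → Prop} (hp : ¬ p (spare G u v h y)) :
    resample u (resample v (excess G H u v h p)) y = 0 := by
  unfold resample
  have : ∀ a b, excess G H u v h p (Function.update (Function.update y u a) v b) = 0 := by
    intro a b
    unfold excess
    rw [if_neg]
    rwa [← spare_congr (y := y)]
    intro w hw
    simp only [Set.mem_compl_iff, Set.mem_insert_iff, Set.mem_singleton_iff, not_or] at hw
    rw [Function.update_of_ne hw.2, Function.update_of_ne hw.1]
  simp [this]

/-- The lower bound on the conditional expectation of the excess, given all ranks but those of `u`
and `v`. -/
theorem Critical.le_resample_excess (hC : Critical G H u v h)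
    (hy : ∀ w, y w ∈ Set.Ico (0 : ℝ) 1) {p : Set V → Prop} (hp : p (spare G u v h y)) {ρ k : ℝ}
    (hρ : ∀ w ∈ spare G u v h y, ρ ≤ y w)
    (hρ' : ρ = 1 ∨ ∃ w ∈ spare G u v h y, y w = ρ)
    (hk : k = 0 ∨ k = 42 / 100 ∧ (spare G u v h y).Nontrivial) :
    base (thr G y {u, v}ᶜ u h) (thr G y {u, v}ᶜ v h) + (1 - thr G y {u, v}ᶜ u h) *
        (k * thr G y {u, v}ᶜ v h + share ρ * (max ρ (thr G y {u, v}ᶜ v h) -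
          thr G y {u, v}ᶜ v h) + (1 - share ρ) * (1 - thr G y {u, v}ᶜ v h)) - 5211 / 10000 ≤
      resample u (resample v (excess G H u v h p)) y := by
  classical
  have hy1 : ∀ w, y w ≤ 1 := fun w => (hy w).2.le
  have hρ1 : ρ ≤ 1 := by
    rcases hρ' with rfl | ⟨w, -, rfl⟩
    · exact le_rfl
    · exact hy1 w
  have hE := bddMeasurable_excess G H u v h p
  have i1 : ∀ a, Integrable (fun b => excess G H u v h p
      (Function.update (Function.update y u a) v b)) unif := fun a => by
    convert (hE.update v (Function.update y u a)).integrable unif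
  have i2 : Integrable (fun a => ∫ b, excess G H u v h p
      (Function.update (Function.update y u a) v b) ∂unif) unif := by
    convert ((hE.resample v).update u y).integrable unif
    unfold resample
    congr!
  have key := le_integral_of_profile_le (s := thr G y {u, v}ᶜ u h) (b := thr G y {u, v}ᶜ v h)
    thr_nonneg (thr_le_one hy1) thr_nonneg (thr_le_one hy1) hρ1 (k := k)
    (T := fun a b => excess G H u v h p (Function.update (Function.update y u a) v b) +
      5211 / 10000)
    (fun a => (i1 a).add (integrable_const _)) ?_ ?_
  · have e1 : ∀ a, ∫ b, (excess G H u v h p (Function.update (Function.update y u a) v b) +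
        5211 / 10000) ∂unif = ∫ b, excess G H u v h p
          (Function.update (Function.update y u a) v b) ∂unif + 5211 / 10000 := fun a => by
      rw [integral_add (i1 a) (integrable_const _)]
      simp
    simp only [e1] at key
    rw [integral_add i2 (integrable_const _)] at key
    have e2 : resample u (resample v (excess G H u v h p)) y = ∫ a, ∫ b, excess G H u v h p
        (Function.update (Function.update y u a) v b) ∂unif ∂unif := by
      unfold resample
      congr!
    rw [e2]
    simp only [integral_const, probReal_univ, smul_eq_mul, one_mul] at key
    linarith
  · simp only [integral_add (i1 _) (integrable_const _)]
    exact i2.add (integrable_const _)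
  · intro a ha b hb
    have huv : u ≠ v := hC.adj.ne
    set z := Function.update (Function.update y u a) v b with hz
    have hzu : z u = a := by rw [hz, Function.update_of_ne huv, Function.update_self]
    have hzv : z v = b := by rw [hz, Function.update_self]
    have hzw : ∀ w ∈ ({u, v}ᶜ : Set V), z w = y w := by
      intro w hw
      simp only [Set.mem_compl_iff, Set.mem_insert_iff, Set.mem_singleton_iff, not_or] at hw
      rw [hz, Function.update_of_ne hw.2, Function.update_of_ne hw.1]
    have hz01 : ∀ w, 0 ≤ z w ∧ z w ≤ 1 := by
      intro w
      by_cases hwv : w = v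
      · rw [hwv, hzv]; exact ⟨hb.1, hb.2.le⟩
      by_cases hwu : w = u
      · rw [hwu, hzu]; exact ⟨ha.1, ha.2.le⟩
      · rw [hzw w (by simp [hwu, hwv])]; exact ⟨(hy w).1, hy1 w⟩
    have hsp : spare G u v h z = spare G u v h y := spare_congr hzw
    have hsub : ∀ w ∈ spare G u v h y, z w = y w := fun w hw => hzw w (free_subset _ hw.2.2)
    have := hC.profile_le hz01 (ρ := ρ) (k := k)
      (by rw [hsp]; intro w hw; rw [hsub w hw]; exact hρ w hw)
      (by
        rw [hsp]
        exact hρ'.imp id fun ⟨w, hw, hh⟩ => ⟨w, hw, (hsub w hw).trans hh⟩)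
      (by rwa [hsp])
    rw [thr_congr hzw, thr_congr (x := v) hzw, hzu, hzv] at this
    refine this.trans (le_of_eq ?_)
    unfold excess
    rw [hsp, if_pos hp]
    ring

/-- If the number of spare neighbors is not one, the excess is nonnegative already in conditional
expectation given all ranks but those of `u` and `v`. -/
theorem Critical.integral_excess_of_ne_singleton (hC : Critical G H u v h) :
    0 ≤ ∫ y, excess G H u v h (fun S => ∀ x, S ≠ {x}) y ∂rankMeasure V := by
  have hE := bddMeasurable_excess G H u v h (fun S => ∀ x, S ≠ {x})
  rw [← integral_resample hE v, ← integral_resample (hE.resample v) u]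
  refine integral_nonneg_of_ae (ae_rankMeasure.mono fun y hy => ?_)
  rw [Pi.zero_apply]
  by_cases hp : ∀ x, spare G u v h y ≠ {x}
  · have hy1 : ∀ w, y w ≤ 1 := fun w => (hy w).2.le
    rcases (spare G u v h y).eq_empty_or_nonempty with h0 | h0
    · have := hC.le_resample_excess hy (p := fun S => ∀ x, S ≠ {x}) hp (ρ := 1) (k := 0)
        (by simp [h0]) (Or.inl rfl) (Or.inl rfl)
      refine le_trans ?_ this
      have hn := bound_no_spare (thr_nonneg (G := G) (y := y) (W := {u, v}ᶜ) (x := u) (h := h))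
        (thr_le_one hy1) (thr_nonneg (G := G) (y := y) (W := {u, v}ᶜ) (x := v) (h := h))
        (thr_le_one hy1)
      rw [max_eq_left (thr_le_one hy1)]
      linarith
    · obtain ⟨m, hm, hmin⟩ := Set.exists_min_image _ y (Set.toFinite _) h0
      have hnt : (spare G u v h y).Nontrivial :=
        (h0.exists_eq_singleton_or_nontrivial).resolve_left fun ⟨x, hx⟩ => hp x hx
      have := hC.le_resample_excess hy (p := fun S => ∀ x, S ≠ {x}) hp hmin
        (Or.inr ⟨m, hm, rfl⟩) (Or.inr ⟨rfl, hnt⟩)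
      refine le_trans ?_ this
      exact sub_nonneg.2 (bound_two_spare thr_nonneg (thr_le_one hy1) thr_nonneg (thr_le_one hy1)
        (hy1 m))
  · exact (resample_excess_of_not (p := fun S => ∀ x, S ≠ {x}) hp).ge

open Classical in
/-- If `x` is the only spare neighbor, the excess need not be nonnegative for every rank of `x`,
but it is on average over that rank. -/
theorem Critical.integral_excess_of_eq_singleton (hC : Critical G H u v h) (x : V) :
    0 ≤ ∫ y, excess G H u v h (fun S => S = {x}) y ∂rankMeasure V := by
  have hE := bddMeasurable_excess G H u v h (fun S => S = {x})
  have hE2 := (hE.resample v).resample u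
  rw [← integral_resample hE v, ← integral_resample (hE.resample v) u, ← integral_resample hE2 x]
  refine integral_nonneg_of_ae (ae_rankMeasure.mono fun y hy => ?_)
  rw [Pi.zero_apply, resample]
  have h2 : ∀ t, ¬ spare G u v h (Function.update y x t) = {x} →
      0 ≤ resample u (resample v (excess G H u v h fun S => S = {x})) (Function.update y x t) :=
    fun t ht => (resample_excess_of_not (p := fun S => S = {x}) ht).ge
  by_cases hU : {t | t ∈ Set.Ico (0 : ℝ) 1 ∧
      spare G u v h (Function.update y x t) = {x}}.Nonempty
  · obtain ⟨t₀, ht₀, hsp₀⟩ := id hU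
    have hy' : ∀ t ∈ Set.Ico (0 : ℝ) 1, ∀ w, Function.update y x t w ∈ Set.Ico (0 : ℝ) 1 := by
      intro t ht w
      by_cases hw : w = x
      · rw [hw, Function.update_self]; exact ht
      · rw [Function.update_of_ne hw]; exact hy w
    have hy₁ : ∀ w, Function.update y x t₀ w ≤ 1 := fun w => (hy' t₀ ht₀ w).2.le
    refine integral_nonneg_of_one_spare thr_nonneg (thr_le_one hy₁) thr_nonneg (thr_le_one hy₁)
      (s := thr G (Function.update y x t₀) {u, v}ᶜ u h)
      (b := thr G (Function.update y x t₀) {u, v}ᶜ v h) ?_ hU (fun t ht => ht.1)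
      ((hE2.update x y).integrable unif) ?_ (fun t ht htU => h2 t fun hh => htU ⟨ht, hh⟩)
    · exact fun t ht t' htt ht' => ⟨⟨ht.1.1.trans htt, ht'⟩, (spare_update_raise htt ht.2).1⟩
    · rintro t ⟨ht, hsp⟩
      have hthr : ∀ z, thr G (Function.update y x t) {u, v}ᶜ z h =
          thr G (Function.update y x t₀) {u, v}ᶜ z h := fun z => by
        rcases le_total t t₀ with hle | hle
        · exact ((spare_update_raise hle hsp).2 z).symm
        · exact (spare_update_raise hle hsp₀).2 z
      have := hC.le_resample_excess (hy' t ht) (p := fun S => S = {x}) hsp (ρ := t) (k := 0)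
        (by rw [hsp]; rintro w rfl; simp) (Or.inr ⟨x, by rw [hsp]; rfl, by simp⟩) (Or.inl rfl)
      rw [hthr, hthr] at this
      rwa [zero_mul, zero_add] at this
  · refine integral_nonneg_of_ae (ae_unif.mono fun t ht => h2 t fun hh => hU ⟨t, ht, hh⟩)

/-- The endpoints of every edge have expected total gain at least `0.5211`. -/
theorem Critical.le_integral_gain (hC : Critical G H u v h) :
    5211 / 10000 ≤ ∫ y, gain G H u y ∂rankMeasure V + ∫ y, gain G H v y ∂rankMeasure V := by
  classical
  have hu := (bddMeasurable_gain G H u).integrable (rankMeasure V)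
  have hv := (bddMeasurable_gain G H v).integrable (rankMeasure V)
  have hsplit : ∀ y, gain G H u y + gain G H v y - 5211 / 10000 =
      excess G H u v h (fun S => ∀ x, S ≠ {x}) y +
        ∑ x, excess G H u v h (fun S => S = {x}) y := by
    intro y
    by_cases hp : ∀ x, spare G u v h y ≠ {x}
    · simp [excess, hp]
    · have hp' := hp
      push Not at hp'
      obtain ⟨x, hx⟩ := hp'
      simp only [excess, hx, Set.singleton_eq_singleton_iff]
      simp
  have hint : ∫ y, (gain G H u y + gain G H v y - 5211 / 10000) ∂rankMeasure V =
      ∫ y, gain G H u y ∂rankMeasure V + ∫ y, gain G H v y ∂rankMeasure V - 5211 / 10000 := by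
    have huv : Integrable (fun y => gain G H u y + gain G H v y) (rankMeasure V) := hu.add hv
    rw [integral_sub huv (integrable_const _), integral_add hu hv]
    simp
  have hx : ∀ p, Integrable (excess G H u v h p) (rankMeasure V) := fun p =>
    (bddMeasurable_excess G H u v h p).integrable _
  simp only [hsplit] at hint
  rw [integral_add (hx _) (integrable_finsetSum _ fun x _ => hx _),
    integral_finsetSum _ fun x _ => hx _] at hint
  have h1 := hC.integral_excess_of_ne_singleton
  have h2 : 0 ≤ ∑ x, ∫ y, excess G H u v h (fun S => S = {x}) y ∂rankMeasure V :=
    Finset.sum_nonneg fun x _ => hC.integral_excess_of_eq_singleton x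
  linarith

end Edge

/-! ### The competitive ratio -/

section Ratio

variable {V : Type*} [Fintype V] (I : Instance V)

theorem Instance.integrable_card_ranking :
    Integrable (fun y : V → ℝ => ((I.ranking y).card : ℝ)) (rankMeasure V) := by
  classical
  refine BddMeasurable.integrable ⟨?_, Fintype.card (Sym2 V), fun y => ?_⟩ _
  · have : Measurable fun y : V → ℝ => (I.ranking y).card := by
      refine measurable_to_countable' fun n => measurableSet_of_order fun y y' hy hn => ?_
      simp only [Set.mem_singleton_iff, I.card_ranking] at hn ⊢
      rwa [← (run_congr_order (h := I.timeline.reverse) fun a _ b _ => hy a b).2]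
    exact measurable_from_top.comp this
  · rw [Nat.abs_cast]
    exact_mod_cast Finset.card_le_univ _

theorem exists_isMatching_of_maxMatchingSize (G : SimpleGraph V) :
    ∃ M : G.Subgraph, M.IsMatching ∧ M.edgeSet.ncard = maxMatchingSize G := by
  refine Nat.sSup_mem (s := {k : ℕ | ∃ M : G.Subgraph, M.IsMatching ∧ M.edgeSet.ncard = k})
    ⟨0, ⊥, by simp [SimpleGraph.Subgraph.IsMatching], by simp⟩ ⟨Nat.card (Sym2 V), ?_⟩
  rintro k ⟨M, -, rfl⟩
  exact Set.ncard_le_card _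

theorem Instance.le_integral_gain {a b : V} (hab : I.graph.Adj a b) :
    5211 / 10000 ≤ ∫ y, gain I.graph I.timeline.reverse a y ∂rankMeasure V +
      ∫ y, gain I.graph I.timeline.reverse b y ∂rankMeasure V := by
  rcases I.exists_critical hab with ⟨h, hC⟩ | ⟨h, hC⟩
  · exact hC.le_integral_gain
  · rw [add_comm]; exact hC.le_integral_gain

theorem Instance.le_integral_card_ranking :
    5211 / 10000 * (maxMatchingSize I.graph : ℝ) ≤
      ∫ y : V → ℝ, ((I.ranking y).card : ℝ) ∂rankMeasure V := by
  classical
  obtain ⟨M, hM, hcard⟩ := exists_isMatching_of_maxMatchingSize I.graph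
  set g : V → ℝ := fun w => ∫ y, gain I.graph I.timeline.reverse w y ∂rankMeasure V with hg
  have hg0 : ∀ w, 0 ≤ g w := fun w => integral_nonneg fun y => gain_nonneg
  have hsum : ∑ w, g w ≤ ∫ y : V → ℝ, ((I.ranking y).card : ℝ) ∂rankMeasure V := by
    rw [← integral_finsetSum _ fun w _ => (bddMeasurable_gain _ _ w).integrable _]
    refine integral_mono
      (integrable_finsetSum _ fun w _ => (bddMeasurable_gain _ _ w).integrable _)
      I.integrable_card_ranking fun y => ?_
    rw [I.card_ranking]
    exact sum_gain_le
  refine le_trans ?_ hsum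
  have hdisj : (M.edgeSet.toFinite.toFinset : Set (Sym2 V)).PairwiseDisjoint Sym2.toFinset := by
    intro e he e' he' hne
    rw [Function.onFun, Finset.disjoint_left]
    intro w hw hw'
    rw [Sym2.mem_toFinset] at hw hw'
    obtain ⟨c, rfl⟩ := Sym2.mem_iff_exists.1 hw
    obtain ⟨d, rfl⟩ := Sym2.mem_iff_exists.1 hw'
    simp only [Set.Finite.coe_toFinset, SimpleGraph.Subgraph.mem_edgeSet] at he he'
    exact hne (by rw [(hM (M.edge_vert he)).unique he he'])
  calc 5211 / 10000 * (maxMatchingSize I.graph : ℝ)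
      = ∑ _e ∈ M.edgeSet.toFinite.toFinset, (5211 / 10000 : ℝ) := by
        rw [Finset.sum_const, ← hcard, Set.ncard_eq_toFinset_card _ M.edgeSet.toFinite,
          nsmul_eq_mul, mul_comm]
    _ ≤ ∑ e ∈ M.edgeSet.toFinite.toFinset, ∑ w ∈ e.toFinset, g w := by
        refine Finset.sum_le_sum fun e he => ?_
        induction e with
        | _ a b =>
          rw [Set.Finite.mem_toFinset, SimpleGraph.Subgraph.mem_edgeSet] at he
          have hab := M.adj_sub he
          rw [Sym2.toFinset_mk_eq, Finset.sum_pair hab.ne]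
          exact I.le_integral_gain hab
    _ = ∑ w ∈ M.edgeSet.toFinite.toFinset.biUnion Sym2.toFinset, g w :=
        (Finset.sum_biUnion hdisj).symm
    _ ≤ ∑ w, g w :=
        Finset.sum_le_sum_of_subset_of_nonneg (Finset.subset_univ _) fun w _ _ => hg0 w

end Ratio

end FullyOnlineMatching

/-- Ranking is `0.5211`-competitive for Fully Online Matching on general graphs: on every instance
it always outputs a matching of the graph, and the expected number of edges of this matching is at
least `0.5211` times the number of edges of a maximum matching. -/
theorem mainTheorem1 {V : Type*} [Fintype V] (I : FullyOnlineMatching.Instance V) :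
    (∀ y : V → ℝ, ∃ M : I.graph.Subgraph,
      M.IsMatching ∧ M.edgeSet = (I.ranking y : Set (Sym2 V))) ∧
    MeasureTheory.Integrable (fun y : V → ℝ => ((I.ranking y).card : ℝ))
      (FullyOnlineMatching.rankMeasure V) ∧
    (0.5211 : ℝ) * (FullyOnlineMatching.maxMatchingSize I.graph : ℝ) ≤
      ∫ y : V → ℝ, ((I.ranking y).card : ℝ) ∂(FullyOnlineMatching.rankMeasure V) := by
  refine ⟨I.exists_isMatching, I.integrable_card_ranking, ?_⟩
  have := I.le_integral_card_ranking
  norm_num at this ⊢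
  exact this
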